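/- Let $k$ be a field and $Q$ a finite quiver. Paths are composed from right to left: $pq$ (first $q$, then $p$) is defined when $s(p)=t(q)$, where $s$ and $t$ denote the starting and the terminating vertex; a path is nontrivial if its length is at least one. In the path algebra $kQ$ (with basis all the paths) the product of paths $p,q$ is the concatenation $pq$ if $s(p)=t(q)$ and $0$ otherwise. Let $J$ be the two-sided ideal of $kQ$ generated by the arrows, let $I$ be a two-sided ideal generated by some paths of length at least two with $J^d\subseteq I\subseteq J^2$ for some $d\ge 2$, and let $A=kQ/I$ be the corresponding (finite-dimensional) monomial algebra. A path $p$ is called nonzero in $A$ if $p\notin I$, and we write $p=0$ in $A$ if $p\in I$; a path is also identified with its image in $A$. For a nonzero nontrivial path $p$, let $L(p)$ be the set of right-minimal paths in $T=\{\text{nonzero paths } q : s(q)=t(p),\ qp=0 \text{ in } A\}$, where $q\in T$ is right-minimal if there is no $q'\in T$ with $q=rq'$ for a nontrivial path $r$. A pair $(p,q)$ of nonzero paths is perfect if: (P1) $p$ and $q$ are nontrivial, $s(p)=t(q)$ and $pq=0$ in $A$; (P2) if $pq'=0$ in $A$ for a nonzero path $q'$ with $t(q')=s(p)$, then $q'=qq''$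 for some path $q''$; (P3) if $p'q=0$ in $A$ for a nonzero path $p'$ with $s(p')=t(q)$, then $p'=p''p$ for some path $p''$. A nonzero path $p$ is perfect if for some $n\ge 1$ there is a sequence $p=p_1,p_2,\dots,p_n,p_{n+1}=p$ of nonzero paths such that $(p_i,p_{i+1})$ is a perfect pair for all $1\le i\le n$. All modules are finite-dimensional left $A$-modules unless stated otherwise. A module $M$ is Gorenstein-projective if there is an acyclic complex $P^\bullet$ (indexed by $\mathbb Z$) of projective modules such that $\mathrm{Hom}_A(P^\bullet,A)$ is also acyclic and $M$ is isomorphic to a cocycle module $Z^i(P^\bullet)=\ker(P^i\to P^{i+1})$ for some $i$. For $a\in A$, let $\theta_a\colon aA\to \mathrm{Hom}_A(Aa,A)$ be the morphism of right $A$-modules with $\theta_a(ax)(y)=yx$ for $x\in A$ and $y\in Aa$. Then the following statements hold. 1. Let $p$ be a nonzero nontrivial path such that $\theta_p$ is an isomorphism. If the $A$-module $Ap$ is non-projective Gorenstein-projective, then the path $p$ is perfect. 2. Let $p$ be a nonzero nontrivial path. If the $A$-module $Ap$ is non-projective Gorenstein-projective, then there is a unique perfect path $q$ such that $L(p)=\{q\}$.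 3. Let $M$ be an indecomposable non-projective Gorenstein-projective $A$-module. Then there is a perfect path $q$ such that $M\simeq Aq$. 4. For every perfect path $p$, the $A$-module $Ap$ is non-projective Gorenstein-projective. -/

import Mathlib

universe u v w x

/-! ## Modules over a ring -/

section Modules

/-- A module is indecomposable if it is nonzero and is not the (internal) direct sum of two nonzero
submodules. -/
def IsIndecomposableModule (A : Type u) [Ring A] (M : Type x) [AddCommGroup M] [Module A M] :
    Prop :=
  Nontrivial M ∧ ∀ N₁ N₂ : Submodule A M, IsCompl N₁ N₂ → N₁ = ⊥ ∨ N₂ = ⊥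

/-- `M` is a Gorenstein-projective (left) `A`-module: there is an acyclic complex
`⋯ → P i → P (i + 1) → ⋯`, indexed by `ℤ`, of finitely generated projective `A`-modules such that
the complex `Hom_A(P, A)` is acyclic too, and `M` is isomorphic to the module of cocycles
`ker (P i → P (i + 1))` for some `i`.

Over a finite-dimensional algebra, finitely generated means finite-dimensional, so that this is
the notion in the category of finite-dimensional modules; such an `M` is itself finitely generated.
The terms `P i` live in the universe of `A`; since every finitely generated `A`-module is isomorphic
to one in that universe, this is no restriction. -/
def IsGorensteinProjective (A : Type u) [Ring A] (M : Type x) [AddCommGroup M] [Module A M] :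
    Prop :=
  ∃ (P : ℤ → ModuleCat.{u} A) (d : ∀ i : ℤ, P i →ₗ[A] P (i + 1)),
    (∀ i, Module.Finite A (P i) ∧ Module.Projective A (P i)) ∧
    (∀ i, Function.Exact (d i) (d (i + 1))) ∧
    (∀ i, Function.Exact
      (fun g : P (i + 1 + 1) →ₗ[A] A => g ∘ₗ d (i + 1))
      (fun f : P (i + 1) →ₗ[A] A => f ∘ₗ d i)) ∧
    ∃ i, Nonempty (M ≃ₗ[A] LinearMap.ker (d i))

variable {A : Type u} [Ring A]

/-- The left ideal `A a`, as a left `A`-module. -/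
abbrev leftIdeal (a : A) : Submodule A A := Submodule.span A {a}

/-- The right ideal `a A`, as a right `A`-module. -/
abbrev rightIdeal (a : A) : Submodule Aᵐᵒᵖ A := Submodule.span Aᵐᵒᵖ {a}

theorem mem_rightIdeal {a z : A} : z ∈ rightIdeal a ↔ ∃ t : A, a * t = z := by
  rw [Submodule.mem_span_singleton]
  exact ⟨fun ⟨r, hr⟩ => ⟨r.unop, hr⟩, fun ⟨t, ht⟩ => ⟨MulOpposite.op t, ht⟩⟩

theorem leftIdeal_mul_congr {a s t y : A} (h : a * s = a * t) (hy : y ∈ leftIdeal a) :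
    y * s = y * t := by
  obtain ⟨b, rfl⟩ := Submodule.mem_span_singleton.1 hy
  rw [smul_eq_mul, mul_assoc, mul_assoc, h]

/-- The morphism of right `A`-modules `θ_a : a A → Hom_A(A a, A)` with `θ_a(a t)(y) = y t`
for `t ∈ A` and `y ∈ A a`; see `theta_apply`. -/
noncomputable def theta (a : A) : rightIdeal a →ₗ[Aᵐᵒᵖ] (leftIdeal a →ₗ[A] A) where
  toFun z :=
    { toFun := fun y => (y : A) * (mem_rightIdeal.1 z.2).choose
      map_add' := fun y y' => by simp [add_mul]
      map_smul' := fun b y => by simp [mul_assoc] }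
  map_add' z z' := by
    ext y
    have h := (mem_rightIdeal.1 z.2).choose_spec
    have h' := (mem_rightIdeal.1 z'.2).choose_spec
    have h'' := (mem_rightIdeal.1 (z + z').2).choose_spec
    simp only [LinearMap.coe_mk, AddHom.coe_mk, LinearMap.add_apply]
    rw [← mul_add]
    refine leftIdeal_mul_congr (a := a) ?_ y.2
    rw [h'', mul_add, h, h']
    rfl
  map_smul' b z := by
    ext y
    have h := (mem_rightIdeal.1 z.2).choose_spec
    have h'' := (mem_rightIdeal.1 (b • z).2).choose_spec
    simp only [LinearMap.coe_mk, AddHom.coe_mk, LinearMap.smul_apply, RingHom.id_apply,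
      MulOpposite.smul_eq_mul_unop]
    rw [mul_assoc]
    refine leftIdeal_mul_congr (a := a) ?_ y.2
    rw [h'', ← mul_assoc, h]
    rfl

theorem theta_apply (a t : A) (h : a * t ∈ rightIdeal a) (y : leftIdeal a) :
    theta a ⟨a * t, h⟩ y = y * t :=
  leftIdeal_mul_congr (a := a) (mem_rightIdeal.1 h).choose_spec y.2

end Modules

/-! ## Paths in a quiver -/

/-- The paths of the quiver `V`, of all lengths and between all vertices: `⟨a, b, p⟩` is the path
`p` that starts at `a` and terminates at `b`. -/
abbrev QPath (V : Type u) [Quiver.{v} V] : Type max u v := Σ a b : V, Quiver.Path a b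

namespace QPath

variable {V : Type u} [Quiver.{v} V]

/-- The starting vertex `s(p)`. -/
def source (p : QPath V) : V := p.1

/-- The terminating vertex `t(p)`. -/
def target (p : QPath V) : V := p.2.1

/-- The number of arrows in `p`. -/
def length (p : QPath V) : ℕ := p.2.2.length

/-- A path of length at least one. -/
def IsNontrivial (p : QPath V) : Prop := 1 ≤ p.length

/-- The trivial path `e_a`. -/
def trivial (a : V) : QPath V := ⟨a, a, Quiver.Path.nil⟩

/-- The concatenation `p q` of two paths with `s(p) = t(q)`: first `q`, then `p`. -/
def comp : (p q : QPath V) → p.source = q.target → QPath V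
  | ⟨_, c, p⟩, ⟨a, _, q⟩, rfl => ⟨a, c, q.comp p⟩

theorem source_comp (p q : QPath V) (h : p.source = q.target) :
    (p.comp q h).source = q.source := by
  obtain ⟨b, c, p⟩ := p
  obtain ⟨a, b', q⟩ := q
  obtain rfl : b = b' := h
  rfl

theorem target_comp (p q : QPath V) (h : p.source = q.target) :
    (p.comp q h).target = p.target := by
  obtain ⟨b, c, p⟩ := p
  obtain ⟨a, b', q⟩ := q
  obtain rfl : b = b' := h
  rfl

theorem comp_assoc (p q r : QPath V) (h : p.source = q.target) (h' : q.source = r.target)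
    (h₁ : (p.comp q h).source = r.target) (h₂ : p.source = (q.comp r h').target) :
    (p.comp q h).comp r h₁ = p.comp (q.comp r h') h₂ := by
  obtain ⟨c, d, p⟩ := p
  obtain ⟨b, c', q⟩ := q
  obtain ⟨a, b', r⟩ := r
  obtain rfl : c = c' := h
  obtain rfl : b = b' := h'
  change (⟨a, d, r.comp (q.comp p)⟩ : QPath V) = ⟨a, d, (r.comp q).comp p⟩
  rw [Quiver.Path.comp_assoc]

theorem trivial_comp (a : V) (q : QPath V) (h : (trivial a).source = q.target) :
    (trivial a).comp q h = q := by
  obtain ⟨b, c, q⟩ := q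
  obtain rfl : a = c := h
  rfl

theorem comp_trivial (p : QPath V) (a : V) (h : p.source = (trivial a).target) :
    p.comp (trivial a) h = p := by
  obtain ⟨b, c, p⟩ := p
  obtain rfl : b = a := h
  change (⟨b, c, Quiver.Path.nil.comp p⟩ : QPath V) = ⟨b, c, p⟩
  rw [Quiver.Path.nil_comp]

end QPath

/-! ## The path algebra -/

/-- The path algebra `k Q` of the quiver `V`: the `k`-vector space with basis all the paths.
The multiplication is defined below. -/
def PathAlgebra (k : Type w) [Field k] (V : Type u) [Quiver.{v} V] : Type max w u v := QPath V →₀ k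

namespace PathAlgebra

variable (k : Type w) [Field k] {V : Type u} [Quiver.{v} V]

noncomputable instance : AddCommGroup (PathAlgebra k V) :=
  inferInstanceAs (AddCommGroup (QPath V →₀ k))

noncomputable instance : Module k (PathAlgebra k V) :=
  inferInstanceAs (Module k (QPath V →₀ k))

/-- A path as an element of the path algebra. -/
noncomputable def of (p : QPath V) : PathAlgebra k V := Finsupp.single p 1

/-- The paths form a basis of the path algebra. -/
noncomputable def basis : Module.Basis (QPath V) k (PathAlgebra k V) :=
  Module.Basis.ofRepr (LinearEquiv.refl k (QPath V →₀ k))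

theorem basis_apply (p : QPath V) : basis k p = of k p := rfl

variable [DecidableEq V]

/-- The product of two paths: the concatenation `p q` if `s(p) = t(q)`, and zero otherwise. -/
noncomputable def pathMul (p q : QPath V) : PathAlgebra k V :=
  if h : p.source = q.target then of k (p.comp q h) else 0

/-- The multiplication of the path algebra, the bilinear extension of `pathMul`. -/
noncomputable def mulHom : PathAlgebra k V →ₗ[k] PathAlgebra k V →ₗ[k] PathAlgebra k V :=
  (basis k).constr k fun p => (basis k).constr k fun q => pathMul k p q

noncomputable instance : Mul (PathAlgebra k V) := ⟨fun f g => mulHom k f g⟩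

theorem mul_def (f g : PathAlgebra k V) : f * g = mulHom k f g := rfl

theorem of_mul_of (p q : QPath V) : of k p * of k q = pathMul k p q := by
  rw [mul_def, mulHom, ← basis_apply, ← basis_apply, Module.Basis.constr_basis,
    Module.Basis.constr_basis]

theorem mul_assoc_of (p q r : QPath V) :
    of k p * of k q * of k r = of k p * (of k q * of k r) := by
  simp only [of_mul_of, pathMul]
  by_cases h : p.source = q.target <;> by_cases h' : q.source = r.target
  · have h₁ : (p.comp q h).source = r.target := by rw [QPath.source_comp, h']
    have h₂ : p.source = (q.comp r h').target := by rw [QPath.target_comp, h]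
    rw [dif_pos h, dif_pos h', of_mul_of, of_mul_of, pathMul, pathMul, dif_pos h₁, dif_pos h₂,
      QPath.comp_assoc]
  · have h₁ : ¬ (p.comp q h).source = r.target := by rwa [QPath.source_comp]
    rw [dif_pos h, dif_neg h', of_mul_of, pathMul, dif_neg h₁, mul_def, map_zero]
  · have h₂ : ¬ p.source = (q.comp r h').target := by rwa [QPath.target_comp]
    rw [dif_neg h, dif_pos h', of_mul_of, pathMul, dif_neg h₂, mul_def, map_zero,
      LinearMap.zero_apply]
  · rw [dif_neg h, dif_neg h', mul_def, mul_def, map_zero, map_zero, LinearMap.zero_apply]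

theorem mul_assoc_aux (f g h : PathAlgebra k V) : f * g * h = f * (g * h) := by
  have h₁ (p q : QPath V) : mulHom k (of k p * of k q) = mulHom k (of k p) ∘ₗ mulHom k (of k q) :=
    (basis k).ext fun r => mul_assoc_of k p q r
  have h₂ (p : QPath V) : (mulHom k).flip h ∘ₗ mulHom k (of k p) =
      mulHom k (of k p) ∘ₗ (mulHom k).flip h :=
    (basis k).ext fun q => LinearMap.congr_fun (h₁ p q) h
  have h₃ : (mulHom k).flip h ∘ₗ (mulHom k).flip g = (mulHom k).flip (g * h) :=
    (basis k).ext fun p => LinearMap.congr_fun (h₂ p) g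
  exact LinearMap.congr_fun h₃ f

variable [Fintype V]

noncomputable instance : One (PathAlgebra k V) := ⟨∑ a : V, of k (QPath.trivial a)⟩

theorem one_mul_of (p : QPath V) : 1 * of k p = of k p := by
  change (∑ a : V, of k (QPath.trivial a)) * of k p = of k p
  rw [mul_def, map_sum, LinearMap.sum_apply, Finset.sum_eq_single p.target]
  · rw [← mul_def, of_mul_of, pathMul,
      dif_pos (show (QPath.trivial p.target).source = p.target from rfl), QPath.trivial_comp]
  · intro a _ ha
    rw [← mul_def, of_mul_of, pathMul, dif_neg]
    exact ha
  · exact fun h => absurd (Finset.mem_univ _) h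

theorem of_mul_one (p : QPath V) : of k p * 1 = of k p := by
  change of k p * (∑ a : V, of k (QPath.trivial a)) = of k p
  rw [mul_def, map_sum, Finset.sum_eq_single p.source]
  · rw [← mul_def, of_mul_of, pathMul,
      dif_pos (show p.source = (QPath.trivial p.source).target from rfl), QPath.comp_trivial]
  · intro a _ ha
    rw [← mul_def, of_mul_of, pathMul, dif_neg]
    exact fun h => ha h.symm
  · exact fun h => absurd (Finset.mem_univ _) h

noncomputable instance : Ring (PathAlgebra k V) :=
  { (inferInstance : AddCommGroup (PathAlgebra k V)) with
    mul := fun f g => f * g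
    one := 1
    left_distrib := fun f g h => map_add (mulHom k f) g h
    right_distrib := fun f g h => by
      change mulHom k (f + g) h = mulHom k f h + mulHom k g h
      rw [map_add, LinearMap.add_apply]
    zero_mul := fun f => by
      change mulHom k 0 f = 0
      rw [map_zero, LinearMap.zero_apply]
    mul_zero := fun f => map_zero (mulHom k f)
    one_mul := fun f => by
      have h : mulHom k (1 : PathAlgebra k V) = LinearMap.id :=
        (basis k).ext fun p => one_mul_of k p
      change mulHom k 1 f = f
      rw [h, LinearMap.id_apply]
    mul_one := fun f => by
      have h : (mulHom k).flip (1 : PathAlgebra k V) = LinearMap.id :=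
        (basis k).ext fun p => of_mul_one k p
      change (mulHom k).flip 1 f = f
      rw [h, LinearMap.id_apply]
    mul_assoc := mul_assoc_aux k }

noncomputable instance : Algebra k (PathAlgebra k V) :=
  Algebra.ofModule (fun c f g => by
    change mulHom k (c • f) g = c • mulHom k f g
    rw [map_smul, LinearMap.smul_apply]) (fun c f g => map_smul (mulHom k f) c g)

/-- The two-sided ideal `J` generated by the arrows. -/
noncomputable def arrowIdeal : TwoSidedIdeal (PathAlgebra k V) :=
  TwoSidedIdeal.span (of k '' {p | p.length = 1})

end PathAlgebra

/-! ## Monomial algebras and perfect paths -/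

section Monomial

variable {k : Type w} [Field k] {V : Type u} [Quiver.{v} V] [DecidableEq V] [Fintype V]

/-- `I` is an admissible ideal: `J ^ d ⊆ I ⊆ J ^ 2` for some `d ≥ 2`, where `J` is the two-sided
ideal generated by the arrows. -/
def IsAdmissible (I : TwoSidedIdeal (PathAlgebra k V)) : Prop :=
  ∃ d : ℕ, 2 ≤ d ∧ (PathAlgebra.arrowIdeal k).asIdeal ^ d ≤ I.asIdeal ∧
    I.asIdeal ≤ (PathAlgebra.arrowIdeal k).asIdeal ^ 2

/-- `I` is a monomial ideal: it is admissible, and generated, as a two-sided ideal, by some paths of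
length at least two. -/
def IsMonomial (I : TwoSidedIdeal (PathAlgebra k V)) : Prop :=
  IsAdmissible I ∧ ∃ S : Set (QPath V), (∀ p ∈ S, 2 ≤ p.length) ∧
    I = TwoSidedIdeal.span (PathAlgebra.of k '' S)

variable (I : TwoSidedIdeal (PathAlgebra k V))

/-- The quotient algebra `A = k Q / I`. -/
abbrev BoundQuiverAlgebra : Type max w u v := PathAlgebra k V ⧸ I.asIdeal

/-- The image of a path in `A = k Q / I`. -/
noncomputable def pathClass (p : QPath V) : BoundQuiverAlgebra I :=
  Ideal.Quotient.mk I.asIdeal (PathAlgebra.of k p)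

/-- The path `p` is zero in `A`, that is, it belongs to `I`. -/
def IsZeroPath (p : QPath V) : Prop := PathAlgebra.of k p ∈ I

/-- The set `L(p)`: the right-minimal paths in the set of the nonzero paths `q` with `s(q) = t(p)`
and `q p = 0` in `A`. A path `q` in a set of paths is right-minimal in it if there is no `q'` in the
set such that `q = r q'` for some nontrivial path `r`. -/
def leftAnnihilatorPaths (p : QPath V) : Set (QPath V) :=
  let T : Set (QPath V) :=
    {q | ¬ IsZeroPath I q ∧ ∃ h : q.source = p.target, IsZeroPath I (q.comp p h)}
  {q ∈ T | ¬ ∃ q' ∈ T, ∃ (r : QPath V) (h : r.source = q'.target),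
    r.IsNontrivial ∧ q = r.comp q' h}

/-- `(p, q)` is a perfect pair of paths in `A`. -/
structure IsPerfectPair (p q : QPath V) : Prop where
  left_nonzero : ¬ IsZeroPath I p
  right_nonzero : ¬ IsZeroPath I q
  left_nontrivial : p.IsNontrivial
  right_nontrivial : q.IsNontrivial
  mul_eq_zero : ∃ h : p.source = q.target, IsZeroPath I (p.comp q h)
  /-- If `p q' = 0` for a nonzero path `q'` with `t(q') = s(p)`, then `q' = q r` for a path `r`. -/
  right_unique : ∀ (q' : QPath V) (h : p.source = q'.target), ¬ IsZeroPath I q' →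
    IsZeroPath I (p.comp q' h) → ∃ (r : QPath V) (h' : q.source = r.target), q' = q.comp r h'
  /-- If `p' q = 0` for a nonzero path `p'` with `s(p') = t(q)`, then `p' = r p` for a path `r`. -/
  left_unique : ∀ (p' : QPath V) (h : p'.source = q.target), ¬ IsZeroPath I p' →
    IsZeroPath I (p'.comp q h) → ∃ (r : QPath V) (h' : r.source = p.target), p' = r.comp p h'

/-- `p` is a perfect path: there are `n ≥ 1` and a sequence `p = s 0, s 1, …, s n = p` of (nonzero)
paths in which any two consecutive members form a perfect pair. -/
def IsPerfectPath (p : QPath V) : Prop :=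
  ∃ (n : ℕ) (s : ℕ → QPath V), 1 ≤ n ∧ s 0 = p ∧ s n = p ∧
    ∀ i < n, IsPerfectPair I (s i) (s (i + 1))

end Monomial

/-!
Fix a monomial algebra `A = k Q / I`. The nonzero paths form a basis of `A`, and the product of two
basis elements is a basis element or zero; together with unique factorization of paths this makes
coefficients of products computable.

*From modules to perfect paths.* Of the Gorenstein-projectivity of `M`, only two consequences are
used: all `Extⁿ(M, A)` with `n ≥ 1` vanish (`IsGorensteinProjective.extVanishing`), and `M` is a
submodule of a free module that is cut out by linear functionals.

Let `p` be a nonzero path such that `A p` is not projective and has no higher extensions by `A`, let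
`e` be the trivial path at `t(p)`, and let `K` be the kernel of `A e → A p`, `y ↦ y p`. It is the
direct sum of the `A q` with `q ∈ L(p)`. Since the first extension group vanishes, every map `K → A`
is the right multiplication by an element of `A`. Applied to the projection of `K` to a summand
`A q`, this rules out a second member of `L(p)` (`leftAnnihilatorPaths_subsingleton`). Hence
`L(p) = {q}` and `K = A q`, all maps `A q → A` are right multiplications, and `A q` has no higher
extensions by `A` by dimension shift. The last two properties imply that `A q` is not projective, so
that the step can be repeated with `q`. If `θ_p` is surjective too, then `(q, p)` is a perfect pair
(`IsExtPerfect.exists_isPerfectPair`). There are only finitely many nonzero paths and a perfect pair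
is determined by its left member, so that the resulting sequence of paths returns to `p`
(`IsExtPerfect.isPerfectPath`).

An indecomposable Gorenstein-projective module, being cut out by linear functionals, is isomorphic
to `A p` for some path `p` (`exists_equiv_leftIdeal_of_isIndecomposable`). If it is not projective,
then `L(p) = {q'}` with `q'` perfect; let `q` be the perfect path that follows `q'` in a cycle of
perfect pairs. Then `p` and `q` terminate at the same vertex `s(q')` and have the same left
annihilator, whence `A p ≃ A q`.

*From perfect paths to modules.* The right multiplications by the members of a cycle of perfect
pairs form a periodic complex of modules `A e`. The conditions on a perfect pair say that this
complex and its dual are exact. Moreover `θ_p` is surjective for a perfect path `p`; if `A p` were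
projective, this would give `p = p t p` for some `t`, but every path in `p t p` is longer than `p`.
-/

/-! ### Vanishing of extensions -/

open CategoryTheory in
/-- `Extⁿ(M, A) = 0` for all `n ≥ 1` (such modules are sometimes called semi-Gorenstein-projective).
This is the only consequence of Gorenstein-projectivity that the argument uses. -/
def ExtVanishing (A : Type u) [Ring A] (M : Type u) [AddCommGroup M] [Module A M] : Prop :=
  ∀ n : ℕ, Subsingleton (Abelian.Ext (ModuleCat.of A M) (ModuleCat.of A A) (n + 1))

section ExtVanishing

open CategoryTheory Abelian

variable {A : Type u} [Ring A] {K P M : Type u} [AddCommGroup K] [Module A K]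
  [AddCommGroup P] [Module A P] [AddCommGroup M] [Module A M]

theorem shortExact_mk {f : K →ₗ[A] P} {g : P →ₗ[A] M} (hf : Function.Injective f)
    (hg : Function.Surjective g) (h : Function.Exact f g) :
    (ShortComplex.mk (ModuleCat.ofHom f) (ModuleCat.ofHom g)
      (by ext y; exact h.apply_apply_eq_zero y)).ShortExact where
  exact := (ShortComplex.ShortExact.moduleCat_exact_iff_function_exact _).2 h
  mono_f := (ModuleCat.mono_iff_injective _).2 hf
  epi_g := (ModuleCat.epi_iff_surjective _).2 hg

/-- Maps to `A` extend along an injection whose cokernel has no extensions by `A`. -/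
theorem ExtVanishing.exists_extend {f : K →ₗ[A] P} {g : P →ₗ[A] M} (hM : ExtVanishing A M)
    (hf : Function.Injective f) (hg : Function.Surjective g) (h : Function.Exact f g)
    (φ : K →ₗ[A] A) : ∃ ψ : P →ₗ[A] A, ψ ∘ₗ f = φ := by
  have hS := shortExact_mk hf hg h
  obtain ⟨x, hx⟩ := Ext.contravariant_sequence_exact₁ hS (ModuleCat.of A A)
    (Ext.mk₀ (ModuleCat.ofHom φ)) (add_zero 1) ((hM 0).elim _ _)
  obtain ⟨ψ, rfl⟩ := (Ext.mk₀_bijective _ _).2 x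
  rw [Ext.mk₀_comp_mk₀] at hx
  have h' := (Ext.mk₀_bijective _ _).1 hx
  exact ⟨ψ.hom, congrArg ModuleCat.Hom.hom h'⟩

theorem ExtVanishing.kernel [Module.Projective A P] {f : K →ₗ[A] P} {g : P →ₗ[A] M}
    (hM : ExtVanishing A M) (hf : Function.Injective f) (hg : Function.Surjective g)
    (h : Function.Exact f g) : ExtVanishing A K := by
  have hS := shortExact_mk hf hg h
  have : Projective (ModuleCat.of A P) := (IsProjective.iff_projective P).1 inferInstance
  refine fun n => subsingleton_of_forall_eq 0 fun e => ?_
  obtain ⟨x, rfl⟩ := Ext.contravariant_sequence_exact₁ hS (ModuleCat.of A A) e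
    (add_comm 1 (n + 1)) ((hM (n + 1)).elim _ _)
  rw [Ext.eq_zero_of_projective x, Ext.comp_zero]

/-- Dimension shift in the converse direction to `ExtVanishing.kernel`. For `n = 0`, the hypothesis
says that maps `K → A` extend to `P`; for `n ≥ 1`, it holds when `Extⁿ(K, A) = 0`. -/
theorem ext_succ_subsingleton [Module.Projective A P] {f : K →ₗ[A] P} {g : P →ₗ[A] M}
    (hf : Function.Injective f) (hg : Function.Surjective g) (h : Function.Exact f g) (n : ℕ)
    (hK : ∀ e : Ext (ModuleCat.of A K) (ModuleCat.of A A) n,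
      ∃ x : Ext (ModuleCat.of A P) (ModuleCat.of A A) n,
        (Ext.mk₀ (ModuleCat.ofHom f)).comp x (zero_add n) = e) :
    Subsingleton (Ext (ModuleCat.of A M) (ModuleCat.of A A) (n + 1)) := by
  have hS := shortExact_mk hf hg h
  have : Projective (ModuleCat.of A P) := (IsProjective.iff_projective P).1 inferInstance
  refine subsingleton_of_forall_eq 0 fun e => ?_
  obtain ⟨y, rfl⟩ := Ext.contravariant_sequence_exact₃ hS (ModuleCat.of A A) e
    (Ext.eq_zero_of_projective _) (add_comm 1 n)
  obtain ⟨x, rfl⟩ := hK y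
  exact hS.extClass_comp_assoc x

theorem ExtVanishing.of_equiv (e : K ≃ₗ[A] M) (hM : ExtVanishing A M) : ExtVanishing A K := by
  refine fun n => subsingleton_of_forall_eq 0 fun x => ?_
  have h := (hM n).elim ((Ext.mk₀ (ModuleCat.ofHom (e.symm : M →ₗ[A] K))).comp x (zero_add _)) 0
  have h' := congrArg (fun y => (Ext.mk₀ (ModuleCat.ofHom (e : K →ₗ[A] M))).comp y (zero_add _)) h
  have he : ModuleCat.ofHom (e : K →ₗ[A] M) ≫ ModuleCat.ofHom (e.symm : M →ₗ[A] K) = 𝟙 _ := by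
    ext y; exact e.symm_apply_apply y
  simpa [Ext.mk₀_comp_mk₀_assoc, he] using h'

theorem IsGorensteinProjective.of_equiv {M : Type v} {N : Type x} [AddCommGroup M] [Module A M]
    [AddCommGroup N] [Module A N] (e : N ≃ₗ[A] M) (h : IsGorensteinProjective A M) :
    IsGorensteinProjective A N := by
  obtain ⟨P, d, h₁, h₂, h₃, i, ⟨f⟩⟩ := h
  exact ⟨P, d, h₁, h₂, h₃, i, ⟨e.trans f⟩⟩

/-- In a complete resolution, every cocycle module is a quotient of a projective module by the
preceding cocycle module, so that all its higher extensions by `A` vanish. -/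
theorem IsGorensteinProjective.extVanishing (h : IsGorensteinProjective A M) :
    ExtVanishing A M := by
  obtain ⟨P, d, hP, hd, hd', i, ⟨e⟩⟩ := h
  refine ExtVanishing.of_equiv e fun n => ?_
  have hex (j : ℤ) : ∃ g : P j →ₗ[A] LinearMap.ker (d (j + 1)), Function.Surjective g ∧
      Function.Exact (LinearMap.ker (d j)).subtype g ∧ ∀ y, (g y : P (j + 1)) = d j y := by
    refine ⟨(d j).codRestrict _ fun y => (hd j).apply_apply_eq_zero y, ?_, ?_, fun y => rfl⟩
    · rintro ⟨y, hy⟩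
      obtain ⟨z, rfl⟩ := (hd j y).1 hy
      exact ⟨z, rfl⟩
    · intro y
      exact ⟨fun hy => ⟨⟨y, congrArg Subtype.val hy⟩, rfl⟩,
        by rintro ⟨z, rfl⟩; exact Subtype.ext z.2⟩
  suffices H : ∀ j : ℤ, Subsingleton (Ext (ModuleCat.of A (LinearMap.ker (d (j + 1))))
      (ModuleCat.of A A) (n + 1)) by
    obtain ⟨j, rfl⟩ : ∃ j, i = j + 1 := ⟨i - 1, by ring⟩
    exact H j
  induction n with
  | zero =>
    intro j
    obtain ⟨j, rfl⟩ : ∃ l, j = l + 1 + 1 := ⟨j - 2, by ring⟩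
    obtain ⟨g, hg, hgex, hgd⟩ := hex (j + 1 + 1)
    obtain ⟨g', hg', -, hgd'⟩ := hex (j + 1)
    have := (hP (j + 1 + 1)).2
    refine ext_succ_subsingleton (Submodule.injective_subtype _) hg hgex 0 fun x => ?_
    obtain ⟨φ, rfl⟩ := (Ext.mk₀_bijective _ _).2 x
    obtain ⟨ψ, hψ⟩ := (hd' j (φ.hom ∘ₗ g')).1 (by
      ext y
      have : g' (d j y) = 0 := Subtype.ext (by rw [hgd']; exact (hd j).apply_apply_eq_zero y)
      simp [this])
    refine ⟨Ext.mk₀ (ModuleCat.ofHom ψ), ?_⟩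
    rw [Ext.mk₀_comp_mk₀]
    congr 1
    ext y
    obtain ⟨z, rfl⟩ := hg' y
    have := LinearMap.congr_fun hψ z
    simpa [hgd'] using this
  | succ n ih =>
    intro j
    obtain ⟨j, rfl⟩ : ∃ l, j = l + 1 := ⟨j - 1, by ring⟩
    obtain ⟨g, hg, hgex, -⟩ := hex (j + 1)
    have := (hP (j + 1)).2
    exact ext_succ_subsingleton (Submodule.injective_subtype _) hg hgex (n + 1)
      fun x => ⟨0, (ih j).elim _ _⟩

end ExtVanishing

/-! ### Cyclic modules -/

section CyclicModules

variable {A : Type u} [Ring A]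

/-- `b a ↦ b c` is a well-defined map `A a → A` when the annihilator of `a` kills `c`. -/
theorem exists_leftIdeal_hom {a c : A} (h : ∀ b : A, b * a = 0 → b * c = 0) :
    ∃ f : leftIdeal a →ₗ[A] A, ∀ (b : A) (hb : b * a ∈ leftIdeal a), f ⟨b * a, hb⟩ = b * c := by
  have hle : LinearMap.ker (LinearMap.toSpanSingleton A A a) ≤
      LinearMap.ker (LinearMap.toSpanSingleton A A c) := fun b hb => h b hb
  have hmem (y : leftIdeal a) : ∃ b : A, b * a = y := Submodule.mem_span_singleton.1 y.2
  have hwd {b b' : A} (hb : b * a = b' * a) : b * c = b' * c := by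
    rw [← sub_eq_zero, ← sub_mul]
    exact h _ (by rw [sub_mul, hb, sub_self])
  choose s hs using hmem
  refine ⟨{ toFun := fun y => s y * c, map_add' := fun y z => ?_, map_smul' := fun r y => ?_ },
    fun b hb => hwd (hs _)⟩
  · rw [← add_mul]
    exact hwd (by rw [hs, add_mul, hs, hs]; rfl)
  · rw [RingHom.id_apply, smul_eq_mul, ← mul_assoc]
    exact hwd (by rw [hs, mul_assoc, hs]; rfl)

theorem mul_mem_leftIdeal (a b : A) : b * a ∈ leftIdeal a :=
  Submodule.mem_span_singleton.2 ⟨b, rfl⟩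

/-- Two elements with the same left annihilator generate isomorphic left ideals. -/
theorem leftIdeal_equiv {a c : A} (h : ∀ b : A, b * a = 0 ↔ b * c = 0) :
    Nonempty (leftIdeal a ≃ₗ[A] leftIdeal c) := by
  obtain ⟨f, hf⟩ := exists_leftIdeal_hom fun b => (h b).1
  obtain ⟨g, hg⟩ := exists_leftIdeal_hom fun b => (h b).2
  have hf' (y) : f y ∈ leftIdeal c := by
    obtain ⟨y, hy⟩ := y
    obtain ⟨b, rfl⟩ := Submodule.mem_span_singleton.1 hy
    exact (hf b hy).symm ▸ mul_mem_leftIdeal c b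
  have hg' (y) : g y ∈ leftIdeal a := by
    obtain ⟨y, hy⟩ := y
    obtain ⟨b, rfl⟩ := Submodule.mem_span_singleton.1 hy
    exact (hg b hy).symm ▸ mul_mem_leftIdeal a b
  refine ⟨LinearEquiv.ofLinearMap (f.codRestrict _ hf') (g.codRestrict _ hg') ?_ ?_⟩
  · ext ⟨y, hy⟩
    obtain ⟨b, rfl⟩ := Submodule.mem_span_singleton.1 hy
    have : (g.codRestrict _ hg') ⟨b • c, hy⟩ = ⟨b * a, mul_mem_leftIdeal a b⟩ :=
      Subtype.ext (hg b hy)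
    simp only [LinearMap.comp_apply, this]
    exact hf b _
  · ext ⟨y, hy⟩
    obtain ⟨b, rfl⟩ := Submodule.mem_span_singleton.1 hy
    have : (f.codRestrict _ hf') ⟨b • a, hy⟩ = ⟨b * c, mul_mem_leftIdeal c b⟩ :=
      Subtype.ext (hf b hy)
    simp only [LinearMap.comp_apply, this]
    exact hg b _

theorem projective_leftIdeal {e : A} (he : e * e = e) : Module.Projective A (leftIdeal e) := by
  refine Module.Projective.of_split (leftIdeal e).subtype
    ((LinearMap.toSpanSingleton A A e).codRestrict _ fun b => mul_mem_leftIdeal e b) ?_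
  ext ⟨y, hy⟩
  obtain ⟨b, rfl⟩ := Submodule.mem_span_singleton.1 hy
  change b * e * e = b * e
  rw [mul_assoc, he]

theorem theta_surjective_iff {a : A} : Function.Surjective (theta a) ↔
    ∀ f : leftIdeal a →ₗ[A] A, ∃ t : A, ∀ y : leftIdeal a, f y = y * t := by
  constructor
  · intro h f
    obtain ⟨⟨z, hz⟩, rfl⟩ := h f
    obtain ⟨t, rfl⟩ := mem_rightIdeal.1 hz
    exact ⟨t, theta_apply a t hz⟩
  · intro h f
    obtain ⟨t, ht⟩ := h f
    exact ⟨⟨a * t, mem_rightIdeal.2 ⟨t, rfl⟩⟩, LinearMap.ext fun y => by rw [theta_apply, ht]⟩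

/-- If `A a` is projective, then `a = a t a` as soon as all maps `A a → A` are right
multiplications. -/
theorem exists_mul_mul_eq_self {a : A} (h : Function.Surjective (theta a))
    (hp : Module.Projective A (leftIdeal a)) : ∃ t : A, a * t * a = a := by
  obtain ⟨s, hs⟩ := Module.projective_lifting_property
    ((LinearMap.toSpanSingleton A A a).codRestrict _ fun b => mul_mem_leftIdeal a b)
    (LinearMap.id : leftIdeal a →ₗ[A] leftIdeal a) (by
      rintro ⟨y, hy⟩
      obtain ⟨b, rfl⟩ := Submodule.mem_span_singleton.1 hy
      exact ⟨b, rfl⟩)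
  obtain ⟨t, ht⟩ := theta_surjective_iff.1 h s
  refine ⟨t, ?_⟩
  have h' : s ⟨a, Submodule.mem_span_singleton_self a⟩ * a = a := congrArg Subtype.val
    (LinearMap.congr_fun hs ⟨a, Submodule.mem_span_singleton_self a⟩)
  rwa [ht] at h'

end CyclicModules

/-! ### Gorenstein-projective modules in free modules -/

section Modules

variable {A : Type u} [Ring A]

theorem IsIndecomposableModule.of_equiv {M : Type v} {N : Type x} [AddCommGroup M] [Module A M]
    [AddCommGroup N] [Module A N] (e : M ≃ₗ[A] N) (h : IsIndecomposableModule A M) :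
    IsIndecomposableModule A N := by
  have := h.1
  refine ⟨e.symm.toEquiv.nontrivial, fun N₁ N₂ hN => ?_⟩
  have hM := (Submodule.orderIsoMapComap e.symm).isCompl hN
  rcases h.2 _ _ hM with h₁ | h₂
  · exact .inl ((map_eq_bot_iff (Submodule.orderIsoMapComap e.symm)).1 h₁)
  · exact .inr ((map_eq_bot_iff (Submodule.orderIsoMapComap e.symm)).1 h₂)

theorem exists_split_embedding (P : Type u) [AddCommGroup P] [Module A P] [Module.Finite A P]
    [Module.Projective A P] : ∃ (n : ℕ) (π : (Fin n → A) →ₗ[A] P) (s : P →ₗ[A] (Fin n → A)),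
      ∀ y, π (s y) = y := by
  obtain ⟨n, π, hπ⟩ := Module.Finite.exists_fin' A P
  obtain ⟨s, hs⟩ := Module.projective_lifting_property π LinearMap.id hπ
  exact ⟨n, π, s, LinearMap.congr_fun hs⟩

/-- A Gorenstein-projective module embeds in a free module of finite rank in such a way that
the quotient embeds in a product of copies of `A`: it is cut out by linear functionals. -/
theorem IsGorensteinProjective.exists_equiv_submodule {M : Type x} [AddCommGroup M] [Module A M]
    (h : IsGorensteinProjective A M) : ∃ (n : ℕ) (K : Submodule A (Fin n → A)),
      Nonempty (M ≃ₗ[A] K) ∧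
      ∀ a, (∀ t : (Fin n → A) →ₗ[A] A, (∀ b ∈ K, t b = 0) → t a = 0) → a ∈ K := by
  obtain ⟨P, d, hP, -, -, i, ⟨e⟩⟩ := h
  have := (hP i).1
  have := (hP i).2
  have := (hP (i + 1)).1
  have := (hP (i + 1)).2
  obtain ⟨n, π, s, hs⟩ := exists_split_embedding (A := A) (P i)
  obtain ⟨m, π', s', hs'⟩ := exists_split_embedding (A := A) (P (i + 1))
  have hinj : Function.Injective s := Function.LeftInverse.injective hs
  refine ⟨n, (LinearMap.ker (d i)).map s,
    ⟨e.trans (Submodule.equivMapOfInjective s hinj _)⟩, fun a ha => ?_⟩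
  refine ⟨π a, ?_, ?_⟩
  · suffices H : s' (d i (π a)) = 0 by
      change d i (π a) = 0
      rw [← hs' (d i (π a)), H, map_zero]
    funext j
    refine ha (LinearMap.proj j ∘ₗ s' ∘ₗ d i ∘ₗ π) ?_
    rintro _ ⟨z, hz, rfl⟩
    have hz' : d i z = 0 := hz
    simp [hs, hz']
  · funext j
    refine (sub_eq_zero.1 (ha (LinearMap.proj j ∘ₗ (LinearMap.id - s ∘ₗ π)) ?_)).symm
    rintro _ ⟨z, hz, rfl⟩
    simp [hs]

end Modules

/-! ### Paths -/

namespace Quiver.Path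

variable {V : Type u} [Quiver.{v} V]

/-- Two factorizations of the same path are comparable. -/
theorem exists_comp_of_comp_eq_comp {a b c b' : V} (y : Path a b) (x : Path b c) (y' : Path a b')
    (x' : Path b' c) (h : y.comp x = y'.comp x') (hl : y'.length ≤ y.length) :
    ∃ z : Path b' b, y = y'.comp z ∧ x' = z.comp x := by
  induction x with
  | nil => exact ⟨x', h, rfl⟩
  | cons x e ih =>
    cases x' with
    | nil =>
      have := congrArg length h
      simp only [comp_cons, length_cons, length_comp, comp_nil] at this
      omega
    | cons x' e' =>
      rw [comp_cons, comp_cons] at h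
      obtain rfl := obj_eq_of_cons_eq_cons h
      obtain ⟨z, hz, hz'⟩ := ih x' (eq_of_heq (heq_of_cons_eq_cons h))
      refine ⟨z, hz, ?_⟩
      rw [hz', comp_cons, eq_of_heq (hom_heq_of_cons_eq_cons h)]

end Quiver.Path

namespace QPath

variable {V : Type u} [Quiver.{v} V]

theorem length_comp (p q : QPath V) (h : p.source = q.target) :
    (p.comp q h).length = p.length + q.length := by
  obtain ⟨b, c, p⟩ := p
  obtain ⟨a, b', q⟩ := q
  obtain rfl : b = b' := h
  exact (Quiver.Path.length_comp q p).trans (add_comm _ _)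

theorem eq_trivial_of_length_eq_zero (p : QPath V) (h : p.length = 0) :
    p = trivial p.source := by
  obtain ⟨a, b, p⟩ := p
  obtain rfl := Quiver.Path.eq_of_length_zero p h
  obtain rfl := Quiver.Path.eq_nil_of_length_zero p h
  rfl

/-- Two factorizations of the same path are comparable. -/
theorem exists_comp_of_comp_eq_comp {x y x' y' : QPath V} {h : x.source = y.target}
    {h' : x'.source = y'.target} (e : x.comp y h = x'.comp y' h') (hl : y'.length ≤ y.length) :
    ∃ (z : QPath V) (hz : z.source = y'.target) (hz' : x.source = z.target),
      y = z.comp y' hz ∧ x' = x.comp z hz' := by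
  obtain ⟨b, c, x⟩ := x
  obtain ⟨a, b₁, y⟩ := y
  obtain ⟨b', c', x'⟩ := x'
  obtain ⟨a', b₁', y'⟩ := y'
  obtain rfl : b = b₁ := h
  obtain rfl : b' = b₁' := h'
  change (⟨a, c, y.comp x⟩ : QPath V) = ⟨a', c', y'.comp x'⟩ at e
  obtain ⟨rfl, e⟩ := Sigma.mk.inj_iff.1 e
  obtain ⟨rfl, e⟩ := Sigma.mk.inj_iff.1 (eq_of_heq e)
  obtain ⟨z, rfl, rfl⟩ := Quiver.Path.exists_comp_of_comp_eq_comp y x y' x' (eq_of_heq e) hl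
  exact ⟨⟨b', b, z⟩, rfl, rfl, rfl, rfl⟩

theorem comp_left_cancel {x y y' : QPath V} {h : x.source = y.target} {h' : x.source = y'.target}
    (e : x.comp y h = x.comp y' h') : y = y' := by
  obtain ⟨b, c, x⟩ := x
  obtain ⟨a, b₁, y⟩ := y
  obtain ⟨a', b₁', y'⟩ := y'
  obtain rfl : b = b₁ := h
  obtain rfl : b = b₁' := h'
  change (⟨a, c, y.comp x⟩ : QPath V) = ⟨a', c, y'.comp x⟩ at e
  obtain ⟨rfl, e⟩ := Sigma.mk.inj_iff.1 e
  obtain ⟨-, e⟩ := Sigma.mk.inj_iff.1 (eq_of_heq e)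
  rw [Quiver.Path.comp_injective_left x (eq_of_heq e)]

theorem comp_right_cancel {x x' y : QPath V} {h : x.source = y.target} {h' : x'.source = y.target}
    (e : x.comp y h = x'.comp y h') : x = x' := by
  obtain ⟨z, hz, hz', hy, rfl⟩ := exists_comp_of_comp_eq_comp e le_rfl
  have hl := congrArg length hy
  rw [length_comp] at hl
  obtain ⟨c, rfl⟩ : ∃ c, z = trivial c := ⟨_, z.eq_trivial_of_length_eq_zero (by omega)⟩
  exact (comp_trivial x c hz').symm

theorem finite_setOf_length_eq [Finite V] [∀ a b : V, Finite (a ⟶ b)] (n : ℕ) :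
    {p : QPath V | p.length = n}.Finite := by
  induction n with
  | zero =>
    refine (Set.finite_range (trivial (V := V))).subset fun p hp => ?_
    exact ⟨p.source, (p.eq_trivial_of_length_eq_zero hp).symm⟩
  | succ n ih =>
    refine (ih.biUnion fun p _ => Set.finite_range fun e : Σ c, (p.target ⟶ c) =>
      (⟨p.source, e.1, p.2.2.cons e.2⟩ : QPath V)).subset ?_
    rintro ⟨a, c, p⟩ hp
    cases p with
    | nil => exact absurd hp (by simp [length])
    | @cons b _ p e =>
      refine Set.mem_biUnion (x := (⟨a, b, p⟩ : QPath V)) ?_ ⟨⟨c, e⟩, rfl⟩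
      simpa [length] using hp

/-- The paths that end on the right with `q`: those of the form `r q`. -/
def leftMultiples (q : QPath V) : Set (QPath V) := {w | ∃ r h, comp r q h = w}

/-- The paths that begin on the left with `p`: those of the form `p r`. -/
def rightMultiples (p : QPath V) : Set (QPath V) := {w | ∃ r h, comp p r h = w}

theorem self_mem_rightMultiples (p : QPath V) : p ∈ rightMultiples p :=
  ⟨trivial p.source, rfl, comp_trivial _ _ _⟩

theorem self_mem_leftMultiples (q : QPath V) : q ∈ leftMultiples q :=
  ⟨trivial q.target, rfl, trivial_comp _ _ _⟩

end QPath

/-! ### The basis of nonzero paths -/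

namespace PathAlgebra

variable {k : Type w} [Field k] {V : Type u} [Quiver.{v} V] [DecidableEq V] [Fintype V]

/-- A two-sided ideal generated by paths is spanned by paths as a vector space. -/
theorem mem_span_of_mem_span_paths {I : TwoSidedIdeal (PathAlgebra k V)} {S : Set (QPath V)}
    (hS : I = TwoSidedIdeal.span (of k '' S)) {f : PathAlgebra k V} (hf : f ∈ I) :
    f ∈ Submodule.span k (of k '' {p | of k p ∈ I}) := by
  have htop (f : PathAlgebra k V) : f ∈ Submodule.span k (Set.range (of (V := V) k)) := by
    have h := (basis (V := V) k).span_eq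
    rw [show ⇑(basis (V := V) k) = of k from funext (basis_apply k)] at h
    rw [h]
    trivial
  have hl : Submodule.span k (Set.range (of (V := V) k)) *
      Submodule.span k (of k '' {p | of k p ∈ I}) ≤
      Submodule.span k (of k '' {p | of k p ∈ I}) := by
    rw [Submodule.span_mul_span, Submodule.span_le]
    rintro _ ⟨_, ⟨p, rfl⟩, _, ⟨q, hq, rfl⟩, rfl⟩
    have h : of k p * of k q ∈ I := I.mul_mem_left _ _ hq
    change of k p * of k q ∈ _
    rw [of_mul_of, pathMul] at h ⊢
    split_ifs at h ⊢
    · exact Submodule.subset_span ⟨_, h, rfl⟩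
    · exact zero_mem _
  have hr : Submodule.span k (of k '' {p | of k p ∈ I}) *
      Submodule.span k (Set.range (of (V := V) k)) ≤
      Submodule.span k (of k '' {p | of k p ∈ I}) := by
    rw [Submodule.span_mul_span, Submodule.span_le]
    rintro _ ⟨_, ⟨q, hq, rfl⟩, _, ⟨p, rfl⟩, rfl⟩
    have h : of k q * of k p ∈ I := I.mul_mem_right _ _ hq
    change of k q * of k p ∈ _
    rw [of_mul_of, pathMul] at h ⊢
    split_ifs at h ⊢
    · exact Submodule.subset_span ⟨_, h, rfl⟩
    · exact zero_mem _
  let N : TwoSidedIdeal (PathAlgebra k V) :=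
    TwoSidedIdeal.mk' (Submodule.span k (of k '' {p | of k p ∈ I})) (zero_mem _)
      (fun h h' => add_mem h h') (fun h => neg_mem h)
      (fun {g _} h => hl (Submodule.mul_mem_mul (htop g) h))
      (fun {_ g} h => hr (Submodule.mul_mem_mul h (htop g)))
  have hN (g : PathAlgebra k V) : g ∈ N ↔ g ∈ Submodule.span k (of k '' {p | of k p ∈ I}) :=
    TwoSidedIdeal.mem_mk' _ _ _ _ _ _ _
  have hle : I ≤ N := by
    conv_lhs => rw [hS]
    rw [TwoSidedIdeal.span_le]
    rintro _ ⟨p, hp, rfl⟩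
    refine (hN _).2 (Submodule.subset_span ⟨p, ?_, rfl⟩)
    rw [Set.mem_ofPred_eq, hS]
    exact TwoSidedIdeal.subset_span ⟨p, hp, rfl⟩
  exact (hN f).1 (hle hf)

end PathAlgebra

section Monomial

variable {k : Type w} [Field k] {V : Type u} [Quiver.{v} V] [DecidableEq V] [Fintype V]
variable {I : TwoSidedIdeal (PathAlgebra k V)}

theorem pathClass_eq_zero_iff {p : QPath V} : pathClass I p = 0 ↔ IsZeroPath I p := by
  rw [pathClass, Ideal.Quotient.eq_zero_iff_mem, TwoSidedIdeal.mem_asIdeal]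
  rfl

theorem pathClass_mul {p q : QPath V} (h : p.source = q.target) :
    pathClass I p * pathClass I q = pathClass I (p.comp q h) := by
  rw [pathClass, pathClass, ← map_mul, PathAlgebra.of_mul_of, PathAlgebra.pathMul, dif_pos h]
  rfl

theorem pathClass_mul_of_ne {p q : QPath V} (h : p.source ≠ q.target) :
    pathClass I p * pathClass I q = 0 := by
  rw [pathClass, pathClass, ← map_mul, PathAlgebra.of_mul_of, PathAlgebra.pathMul, dif_neg h,
    map_zero]

theorem IsZeroPath.comp_left {p q : QPath V} (h : p.source = q.target) (hq : IsZeroPath I q) :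
    IsZeroPath I (p.comp q h) := by
  rw [← pathClass_eq_zero_iff] at hq ⊢
  rw [← pathClass_mul, hq, mul_zero]

theorem pathClass_mul_trivial (p : QPath V) :
    pathClass I p * pathClass I (QPath.trivial p.source) = pathClass I p := by
  have h : p.source = (QPath.trivial p.source).target := rfl
  rw [pathClass_mul h, QPath.comp_trivial]

theorem trivial_mul_pathClass (p : QPath V) :
    pathClass I (QPath.trivial p.target) * pathClass I p = pathClass I p := by
  have h : (QPath.trivial p.target).source = p.target := rfl
  rw [pathClass_mul h, QPath.trivial_comp]

variable (I) in
/-- The nonzero paths span the algebra. -/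
theorem span_pathClass :
    Submodule.span k (Set.range fun p : {p : QPath V // ¬ IsZeroPath I p} => pathClass I p) =
      ⊤ := by
  have h := congrArg (Submodule.map (Ideal.Quotient.mkₐ k I.asIdeal).toLinearMap)
    (PathAlgebra.basis (V := V) k).span_eq
  rw [Submodule.map_span, Submodule.map_top, LinearMap.range_eq_top.2
    (Ideal.Quotient.mkₐ_surjective k I.asIdeal)] at h
  rw [← top_le_iff, ← h, Submodule.span_le]
  rintro _ ⟨_, ⟨p, rfl⟩, rfl⟩
  change pathClass I p ∈ _
  by_cases hp : IsZeroPath I p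
  · rw [pathClass_eq_zero_iff.2 hp]
    exact zero_mem _
  · exact Submodule.subset_span ⟨⟨p, hp⟩, rfl⟩

theorem linearIndependent_pathClass (hI : IsMonomial I) :
    LinearIndependent k fun p : {p : QPath V // ¬ IsZeroPath I p} => pathClass I p := by
  have h := (PathAlgebra.basis (V := V) k).linearIndependent
  refine (h.comp (Subtype.val : {p : QPath V // ¬ IsZeroPath I p} → QPath V)
    Subtype.val_injective).map (f := (Ideal.Quotient.mkₐ k I.asIdeal).toLinearMap) ?_
  have hd := h.disjoint_span_image (s := {p | ¬ IsZeroPath I p}) (t := {p | IsZeroPath I p})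
    (Set.disjoint_left.2 fun p hp hp' => hp hp')
  refine hd.mono (le_of_eq ?_) ?_
  · rw [Set.range_comp, Subtype.range_coe_subtype]
  · intro f hf
    obtain ⟨S, -, hS⟩ := hI.2
    refine PathAlgebra.mem_span_of_mem_span_paths hS ?_
    rw [← TwoSidedIdeal.mem_asIdeal]
    exact Ideal.Quotient.eq_zero_iff_mem.1 hf

/-- The nonzero paths form a basis of a monomial algebra. -/
noncomputable def pathBasis (hI : IsMonomial I) :
    Module.Basis {p : QPath V // ¬ IsZeroPath I p} k (BoundQuiverAlgebra I) :=
  Module.Basis.mk (linearIndependent_pathClass hI) (span_pathClass I).ge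

theorem pathBasis_apply (hI : IsMonomial I) (p : {p : QPath V // ¬ IsZeroPath I p}) :
    pathBasis hI p = pathClass I p :=
  Module.Basis.mk_apply _ _ _

open Classical in
/-- The coefficient of the path `p` in an element of a monomial algebra, which is zero by
convention if `p` is a zero path. -/
noncomputable def coef (hI : IsMonomial I) (p : QPath V) : BoundQuiverAlgebra I →ₗ[k] k :=
  if h : IsZeroPath I p then 0 else (pathBasis hI).coord ⟨p, h⟩

theorem coef_self (hI : IsMonomial I) {p : QPath V} (hp : ¬ IsZeroPath I p) :
    coef hI p (pathClass I p) = 1 := by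
  rw [coef, dif_neg hp, ← pathBasis_apply hI ⟨p, hp⟩, Module.Basis.coord_apply,
    Module.Basis.repr_self, Finsupp.single_eq_same]

theorem coef_of_ne (hI : IsMonomial I) {p q : QPath V} (h : q ≠ p) :
    coef hI p (pathClass I q) = 0 := by
  by_cases hq : IsZeroPath I q
  · rw [pathClass_eq_zero_iff.2 hq, map_zero]
  · rw [coef]
    split_ifs with hp
    · rfl
    · rw [← pathBasis_apply hI ⟨q, hq⟩, Module.Basis.coord_apply, Module.Basis.repr_self,
        Finsupp.single_eq_of_ne]
      simpa using h.symm

theorem linearMap_ext (hI : IsMonomial I) {N : Type*} [AddCommGroup N] [Module k N]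
    {f g : BoundQuiverAlgebra I →ₗ[k] N}
    (h : ∀ p, ¬ IsZeroPath I p → f (pathClass I p) = g (pathClass I p)) : f = g :=
  (pathBasis hI).ext fun p => by rw [pathBasis_apply]; exact h p p.2

theorem mem_of_coef (hI : IsMonomial I) {N : Submodule k (BoundQuiverAlgebra I)}
    {a : BoundQuiverAlgebra I}
    (h : ∀ p, ¬ IsZeroPath I p → coef hI p a ≠ 0 → pathClass I p ∈ N) : a ∈ N := by
  rw [← (pathBasis hI).linearCombination_repr a]
  refine N.sum_mem fun p hp => N.smul_mem _ ?_
  rw [pathBasis_apply]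
  refine h p p.2 ?_
  rw [coef, dif_neg p.2]
  exact Finsupp.mem_support_iff.1 hp

theorem eq_zero_of_coef (hI : IsMonomial I) {a : BoundQuiverAlgebra I}
    (h : ∀ p, ¬ IsZeroPath I p → coef hI p a = 0) : a = 0 := by
  have : a ∈ (⊥ : Submodule k (BoundQuiverAlgebra I)) :=
    mem_of_coef hI fun p hp hp' => absurd (h p hp) hp'
  simpa using this

theorem coef_comp_pathClass_mul (hI : IsMonomial I) {p q : QPath V} (h : p.source = q.target)
    (hpq : ¬ IsZeroPath I (p.comp q h)) (b : BoundQuiverAlgebra I) :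
    coef hI (p.comp q h) (pathClass I p * b) = coef hI q b := by
  suffices H : coef hI (p.comp q h) ∘ₗ LinearMap.mulLeft k (pathClass I p) = coef hI q from
    LinearMap.congr_fun H b
  refine linearMap_ext hI fun r hr => ?_
  change coef hI (p.comp q h) (pathClass I p * pathClass I r) = _
  by_cases hrq : r = q
  · subst hrq
    rw [pathClass_mul h, coef_self hI hpq, coef_self hI hr]
  · rw [coef_of_ne hI hrq]
    by_cases h' : p.source = r.target
    · rw [pathClass_mul h', coef_of_ne]
      exact fun e => hrq (QPath.comp_left_cancel e)
    · rw [pathClass_mul_of_ne h', map_zero]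

theorem coef_pathClass_mul_of_forall_ne (hI : IsMonomial I) {p w : QPath V}
    (h : ∀ q h, p.comp q h ≠ w) (b : BoundQuiverAlgebra I) :
    coef hI w (pathClass I p * b) = 0 := by
  suffices H : coef hI w ∘ₗ LinearMap.mulLeft k (pathClass I p) = 0 from LinearMap.congr_fun H b
  refine linearMap_ext hI fun r hr => ?_
  change coef hI w (pathClass I p * pathClass I r) = 0
  by_cases h' : p.source = r.target
  · rw [pathClass_mul h', coef_of_ne hI (h r h')]
  · rw [pathClass_mul_of_ne h', map_zero]

theorem coef_mul_pathClass_of_forall_ne (hI : IsMonomial I) {p w : QPath V}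
    (h : ∀ q h, QPath.comp q p h ≠ w) (b : BoundQuiverAlgebra I) :
    coef hI w (b * pathClass I p) = 0 := by
  suffices H : coef hI w ∘ₗ LinearMap.mulRight k (pathClass I p) = 0 from LinearMap.congr_fun H b
  refine linearMap_ext hI fun r hr => ?_
  change coef hI w (pathClass I r * pathClass I p) = 0
  by_cases h' : r.source = p.target
  · rw [pathClass_mul h', coef_of_ne hI (h r h')]
  · rw [pathClass_mul_of_ne h', map_zero]

theorem coef_comp_mul_pathClass (hI : IsMonomial I) {p q : QPath V} (h : p.source = q.target)
    (hpq : ¬ IsZeroPath I (p.comp q h)) (b : BoundQuiverAlgebra I) :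
    coef hI (p.comp q h) (b * pathClass I q) = coef hI p b := by
  suffices H : coef hI (p.comp q h) ∘ₗ LinearMap.mulRight k (pathClass I q) = coef hI p from
    LinearMap.congr_fun H b
  refine linearMap_ext hI fun r hr => ?_
  change coef hI (p.comp q h) (pathClass I r * pathClass I q) = _
  by_cases hrp : r = p
  · subst hrp
    rw [pathClass_mul h, coef_self hI hpq, coef_self hI hr]
  · rw [coef_of_ne hI hrp]
    by_cases h' : r.source = q.target
    · rw [pathClass_mul h', coef_of_ne]
      exact fun e => hrp (QPath.comp_right_cancel e)
    · rw [pathClass_mul_of_ne h', map_zero]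

/-- The coefficient of `p` in `p b` is the one of the trivial path in `b`. -/
theorem coef_pathClass_mul_self (hI : IsMonomial I) {p : QPath V} (hp : ¬ IsZeroPath I p)
    (b : BoundQuiverAlgebra I) :
    coef hI p (pathClass I p * b) = coef hI (QPath.trivial p.source) b := by
  have h : p.source = (QPath.trivial p.source).target := rfl
  have h' := QPath.comp_trivial p _ h
  have := coef_comp_pathClass_mul hI h (by rwa [h']) b
  rwa [h'] at this

/-! ### Finiteness -/

theorem of_mem_arrowIdeal_pow {p : QPath V} (hp : p.IsNontrivial) :
    PathAlgebra.of k p ∈ (PathAlgebra.arrowIdeal k).asIdeal ^ p.length := by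
  obtain ⟨a, b, p⟩ := p
  have harrow {b c : V} (e : b ⟶ c) : PathAlgebra.of k (⟨b, c, e.toPath⟩ : QPath V) ∈
      (PathAlgebra.arrowIdeal (V := V) k).asIdeal :=
    TwoSidedIdeal.mem_asIdeal.2 (TwoSidedIdeal.subset_span ⟨_, rfl, rfl⟩)
  induction p with
  | nil => exact absurd hp (by simp [QPath.IsNontrivial, QPath.length])
  | @cons b c p e ih =>
    cases p with
    | nil =>
      change _ ∈ _ ^ 1
      rw [Submodule.pow_one]
      exact harrow e
    | @cons b' _ p e' =>
      have h : PathAlgebra.of k (⟨a, c, (p.cons e').cons e⟩ : QPath V) =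
          PathAlgebra.of k (⟨b, c, e.toPath⟩ : QPath V) *
            PathAlgebra.of k (⟨a, b, p.cons e'⟩ : QPath V) := by
        have hc : QPath.source (⟨b, c, e.toPath⟩ : QPath V) =
          QPath.target (⟨a, b, p.cons e'⟩ : QPath V) := rfl
        rw [PathAlgebra.of_mul_of, PathAlgebra.pathMul, dif_pos hc]
        rfl
      change _ ∈ _ ^ (QPath.length (⟨a, b, p.cons e'⟩ : QPath V) + 1)
      rw [h, Ideal.IsTwoSided.pow_succ]
      exact Ideal.mul_mem_mul (harrow e) (ih (Nat.succ_le_succ (Nat.zero_le _)))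

theorem IsMonomial.exists_isZeroPath_of_le_length (hI : IsMonomial I) :
    ∃ d : ℕ, ∀ p : QPath V, d ≤ p.length → IsZeroPath I p := by
  obtain ⟨⟨d, hd2, hd, -⟩, -⟩ := hI
  refine ⟨d, fun p hp => ?_⟩
  obtain ⟨a, b, p⟩ := p
  induction p with
  | nil =>
    simp only [QPath.length, Quiver.Path.length_nil] at hp
    omega
  | @cons b c p e ih =>
    rcases hp.eq_or_lt with hp | hp
    · have h := of_mem_arrowIdeal_pow (k := k) (p := (⟨a, c, p.cons e⟩ : QPath V))
        (Nat.succ_le_succ (Nat.zero_le _))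
      rw [← hp] at h
      exact TwoSidedIdeal.mem_asIdeal.1 (hd h)
    · exact IsZeroPath.comp_left (p := ⟨b, c, e.toPath⟩) (q := ⟨a, b, p⟩) rfl
        (ih (Nat.lt_succ_iff.1 hp))

variable [∀ a b : V, Finite (a ⟶ b)]

theorem IsMonomial.finite_nonzero_paths (hI : IsMonomial I) :
    {p : QPath V | ¬ IsZeroPath I p}.Finite := by
  obtain ⟨d, hd⟩ := hI.exists_isZeroPath_of_le_length
  refine ((Set.finite_lt_nat d).biUnion fun n _ =>
    QPath.finite_setOf_length_eq (V := V) n).subset ?_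
  intro p hp
  exact Set.mem_biUnion (x := p.length) (lt_of_not_ge fun h => hp (hd p h)) rfl

theorem IsMonomial.module_finite (hI : IsMonomial I) : Module.Finite k (BoundQuiverAlgebra I) := by
  have : Finite {p : QPath V // ¬ IsZeroPath I p} := hI.finite_nonzero_paths
  exact Module.Finite.of_basis (pathBasis hI)

end Monomial

section Monomial

variable {k : Type w} [Field k] {V : Type u} [Quiver.{v} V] [DecidableEq V] [Fintype V]
variable {I : TwoSidedIdeal (PathAlgebra k V)}

/-! ### Projections onto sets of paths -/

open Classical in
/-- The projection of a monomial algebra onto the span of the paths in `S`, along the span of the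
other paths. It is linear over `k` only. -/
noncomputable def pathProj (hI : IsMonomial I) (S : Set (QPath V)) :
    BoundQuiverAlgebra I →ₗ[k] BoundQuiverAlgebra I :=
  (pathBasis hI).constr k fun p => if (p : QPath V) ∈ S then pathClass I p else 0

theorem pathProj_of_mem (hI : IsMonomial I) {S : Set (QPath V)} {p : QPath V} (hp : p ∈ S) :
    pathProj hI S (pathClass I p) = pathClass I p := by
  by_cases h : IsZeroPath I p
  · rw [pathClass_eq_zero_iff.2 h, map_zero]
  · rw [pathProj, ← pathBasis_apply hI ⟨p, h⟩, Module.Basis.constr_basis, if_pos hp,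
      pathBasis_apply]

theorem pathProj_of_notMem (hI : IsMonomial I) {S : Set (QPath V)} {p : QPath V} (hp : p ∉ S) :
    pathProj hI S (pathClass I p) = 0 := by
  by_cases h : IsZeroPath I p
  · rw [pathClass_eq_zero_iff.2 h, map_zero]
  · rw [pathProj, ← pathBasis_apply hI ⟨p, h⟩, Module.Basis.constr_basis, if_neg hp]

theorem coef_pathProj (hI : IsMonomial I) {S : Set (QPath V)} {p : QPath V} (hp : p ∈ S)
    (a : BoundQuiverAlgebra I) : coef hI p (pathProj hI S a) = coef hI p a := by
  suffices H : coef hI p ∘ₗ pathProj hI S = coef hI p from LinearMap.congr_fun H a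
  refine linearMap_ext hI fun q hq => ?_
  rw [LinearMap.comp_apply]
  by_cases h : q ∈ S
  · rw [pathProj_of_mem hI h]
  · rw [pathProj_of_notMem hI h, map_zero, coef_of_ne]
    rintro rfl
    exact h hp

theorem pathProj_mem (hI : IsMonomial I) {S : Set (QPath V)}
    {N : Submodule k (BoundQuiverAlgebra I)} (h : ∀ p ∈ S, pathClass I p ∈ N)
    (a : BoundQuiverAlgebra I) : pathProj hI S a ∈ N := by
  suffices H : a ∈ N.comap (pathProj hI S) from H
  refine mem_of_coef hI fun p hp _ => ?_
  rw [Submodule.mem_comap]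
  by_cases hS : p ∈ S
  · rw [pathProj_of_mem hI hS]
    exact h p hS
  · rw [pathProj_of_notMem hI hS]
    exact zero_mem _

/-- The projection onto the span of `S` commutes with left multiplications of `a`, if membership
in `S` is unaffected by extending the paths in the support of `a` to the left. -/
theorem pathProj_mul_left (hI : IsMonomial I) {S : Set (QPath V)} {a : BoundQuiverAlgebra I}
    (h : ∀ q, ¬ IsZeroPath I q → coef hI q a ≠ 0 → ∀ r h, ¬ IsZeroPath I (QPath.comp r q h) →
      (QPath.comp r q h ∈ S ↔ q ∈ S)) (b : BoundQuiverAlgebra I) :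
    pathProj hI S (b * a) = b * pathProj hI S a := by
  suffices H : a ∈ LinearMap.eqLocus (pathProj hI S ∘ₗ LinearMap.mulLeft k b)
      (LinearMap.mulLeft k b ∘ₗ pathProj hI S) from H
  refine mem_of_coef hI fun q hq hqa => ?_
  change pathProj hI S (b * pathClass I q) = b * pathProj hI S (pathClass I q)
  suffices H : pathProj hI S ∘ₗ LinearMap.mulRight k (pathClass I q) =
      LinearMap.mulRight k (pathProj hI S (pathClass I q)) from LinearMap.congr_fun H b
  refine linearMap_ext hI fun r hr => ?_
  change pathProj hI S (pathClass I r * pathClass I q) =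
    pathClass I r * pathProj hI S (pathClass I q)
  by_cases hrq : r.source = q.target
  · by_cases hz : IsZeroPath I (r.comp q hrq)
    · by_cases hqS : q ∈ S
      · rw [pathProj_of_mem hI hqS, pathClass_mul hrq, pathClass_eq_zero_iff.2 hz, map_zero]
      · rw [pathProj_of_notMem hI hqS, pathClass_mul hrq, pathClass_eq_zero_iff.2 hz, map_zero,
          mul_zero]
    · have hiff := h q hq hqa r hrq hz
      by_cases hqS : q ∈ S
      · rw [pathProj_of_mem hI hqS, pathClass_mul hrq, pathProj_of_mem hI (hiff.2 hqS)]
      · rw [pathProj_of_notMem hI hqS, pathClass_mul hrq,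
          pathProj_of_notMem hI fun h => hqS (hiff.1 h), mul_zero]
  · rw [pathClass_mul_of_ne hrq, map_zero]
    by_cases hqS : q ∈ S
    · rw [pathProj_of_mem hI hqS, pathClass_mul_of_ne hrq]
    · rw [pathProj_of_notMem hI hqS, mul_zero]

/-- The projection onto the span of `S` commutes with right multiplications of `a`, if membership
in `S` is unaffected by extending the paths in the support of `a` to the right. -/
theorem pathProj_mul_right (hI : IsMonomial I) {S : Set (QPath V)} {a : BoundQuiverAlgebra I}
    (h : ∀ q, ¬ IsZeroPath I q → coef hI q a ≠ 0 → ∀ r h, ¬ IsZeroPath I (QPath.comp q r h) →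
      (QPath.comp q r h ∈ S ↔ q ∈ S)) (b : BoundQuiverAlgebra I) :
    pathProj hI S (a * b) = pathProj hI S a * b := by
  suffices H : a ∈ LinearMap.eqLocus (pathProj hI S ∘ₗ LinearMap.mulRight k b)
      (LinearMap.mulRight k b ∘ₗ pathProj hI S) from H
  refine mem_of_coef hI fun q hq hqa => ?_
  change pathProj hI S (pathClass I q * b) = pathProj hI S (pathClass I q) * b
  suffices H : pathProj hI S ∘ₗ LinearMap.mulLeft k (pathClass I q) =
      LinearMap.mulLeft k (pathProj hI S (pathClass I q)) from LinearMap.congr_fun H b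
  refine linearMap_ext hI fun r hr => ?_
  change pathProj hI S (pathClass I q * pathClass I r) =
    pathProj hI S (pathClass I q) * pathClass I r
  by_cases hqr : q.source = r.target
  · by_cases hz : IsZeroPath I (q.comp r hqr)
    · by_cases hqS : q ∈ S
      · rw [pathProj_of_mem hI hqS, pathClass_mul hqr, pathClass_eq_zero_iff.2 hz, map_zero]
      · rw [pathProj_of_notMem hI hqS, pathClass_mul hqr, pathClass_eq_zero_iff.2 hz, map_zero,
          zero_mul]
    · have hiff := h q hq hqa r hqr hz
      by_cases hqS : q ∈ S
      · rw [pathProj_of_mem hI hqS, pathClass_mul hqr, pathProj_of_mem hI (hiff.2 hqS)]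
      · rw [pathProj_of_notMem hI hqS, pathClass_mul hqr,
          pathProj_of_notMem hI fun h => hqS (hiff.1 h), zero_mul]
  · rw [pathClass_mul_of_ne hqr, map_zero]
    by_cases hqS : q ∈ S
    · rw [pathProj_of_mem hI hqS, pathClass_mul_of_ne hqr]
    · rw [pathProj_of_notMem hI hqS, zero_mul]

/-! ### Annihilators of paths -/

theorem isZeroPath_comp_of_mul_eq_zero (hI : IsMonomial I) {p w : QPath V}
    {a : BoundQuiverAlgebra I} (ha : a * pathClass I p = 0) (hw : coef hI w a ≠ 0)
    (h : w.source = p.target) : IsZeroPath I (w.comp p h) := by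
  by_contra hz
  exact hw (by rw [← coef_comp_mul_pathClass hI h hz, ha, map_zero])

theorem isZeroPath_comp_of_pathClass_mul_eq_zero (hI : IsMonomial I) {p w : QPath V}
    {a : BoundQuiverAlgebra I} (ha : pathClass I p * a = 0) (hw : coef hI w a ≠ 0)
    (h : p.source = w.target) : IsZeroPath I (p.comp w h) := by
  by_contra hz
  exact hw (by rw [← coef_comp_pathClass_mul hI h hz, ha, map_zero])

theorem source_eq_of_coef_ne_zero (hI : IsMonomial I) {c : V} {w : QPath V}
    {a : BoundQuiverAlgebra I} (ha : a ∈ leftIdeal (pathClass I (QPath.trivial c)))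
    (hw : coef hI w a ≠ 0) : w.source = c := by
  obtain ⟨b, rfl⟩ := Submodule.mem_span_singleton.1 ha
  by_contra hne
  refine hw (coef_mul_pathClass_of_forall_ne hI (fun q h e => hne ?_) b)
  rw [← e, QPath.source_comp]
  rfl

theorem target_eq_of_coef_ne_zero (hI : IsMonomial I) {c : V} {w : QPath V}
    {a : BoundQuiverAlgebra I} (ha : pathClass I (QPath.trivial c) * a = a)
    (hw : coef hI w a ≠ 0) : w.target = c := by
  by_contra hne
  rw [← ha] at hw
  refine hw (coef_pathClass_mul_of_forall_ne hI (fun q h e => hne ?_) a)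
  rw [← e, QPath.target_comp]
  rfl

theorem pathClass_trivial_mul_self (c : V) :
    pathClass I (QPath.trivial c) * pathClass I (QPath.trivial c) =
      pathClass I (QPath.trivial c) :=
  trivial_mul_pathClass (QPath.trivial c)

instance projective_leftIdeal_trivial (c : V) :
    Module.Projective (BoundQuiverAlgebra I) (leftIdeal (pathClass I (QPath.trivial c))) :=
  projective_leftIdeal (pathClass_trivial_mul_self c)

variable (I) in
/-- The syzygy of `A p`: the kernel of the map `A e → A p` given by `y ↦ y p`, where `e` is the
trivial path at the terminating vertex of `p`. -/
noncomputable def pathSyzygy (p : QPath V) :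
    Submodule (BoundQuiverAlgebra I) (BoundQuiverAlgebra I) :=
  leftIdeal (pathClass I (QPath.trivial p.target)) ⊓
    LinearMap.ker (LinearMap.toSpanSingleton _ (BoundQuiverAlgebra I) (pathClass I p))

theorem mem_pathSyzygy {p : QPath V} {a : BoundQuiverAlgebra I} : a ∈ pathSyzygy I p ↔
    a ∈ leftIdeal (pathClass I (QPath.trivial p.target)) ∧ a * pathClass I p = 0 :=
  Iff.rfl

theorem pathSyzygy_le (p : QPath V) :
    pathSyzygy I p ≤ leftIdeal (pathClass I (QPath.trivial p.target)) :=
  inf_le_left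

theorem pathClass_mem_pathSyzygy {p q : QPath V} (h : q.source = p.target)
    (hz : IsZeroPath I (q.comp p h)) : pathClass I q ∈ pathSyzygy I p := by
  refine ⟨?_, ?_⟩
  · rw [← pathClass_mul_trivial q, h]
    exact mul_mem_leftIdeal _ _
  · change pathClass I q * pathClass I p = 0
    rw [pathClass_mul h, pathClass_eq_zero_iff.2 hz]

theorem exists_shortExact_pathSyzygy (p : QPath V) :
    ∃ g : leftIdeal (pathClass I (QPath.trivial p.target)) →ₗ[BoundQuiverAlgebra I]
        leftIdeal (pathClass I p), Function.Surjective g ∧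
      Function.Exact (Submodule.inclusion (pathSyzygy_le p)) g ∧
      ∀ y, (g y : BoundQuiverAlgebra I) = y * pathClass I p := by
  refine ⟨((LinearMap.toSpanSingleton _ (BoundQuiverAlgebra I) (pathClass I p)).comp
    (Submodule.subtype _)).codRestrict _ fun y => mul_mem_leftIdeal _ _, ?_, ?_, fun y => rfl⟩
  · rintro ⟨y, hy⟩
    obtain ⟨b, rfl⟩ := Submodule.mem_span_singleton.1 hy
    refine ⟨⟨b * pathClass I (QPath.trivial p.target), mul_mem_leftIdeal _ _⟩, Subtype.ext ?_⟩
    change b * _ * _ = b * _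
    rw [mul_assoc, trivial_mul_pathClass]
  · intro y
    refine ⟨fun h => ⟨⟨y, y.2, congrArg Subtype.val h⟩, rfl⟩, ?_⟩
    rintro ⟨z, rfl⟩
    exact Subtype.ext z.2.2

/-- The maps from the syzygy of `A p` to `A` extend to `A e`, so they are right multiplications. -/
theorem exists_eq_mul_of_extVanishing {p : QPath V}
    (h : ExtVanishing (BoundQuiverAlgebra I) (leftIdeal (pathClass I p)))
    (φ : pathSyzygy I p →ₗ[BoundQuiverAlgebra I] BoundQuiverAlgebra I) :
    ∃ x : BoundQuiverAlgebra I, ∀ y, φ y = y * x := by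
  obtain ⟨g, hg, hex, -⟩ := exists_shortExact_pathSyzygy (I := I) p
  obtain ⟨ψ, rfl⟩ := h.exists_extend (Submodule.inclusion_injective _) hg hex φ
  let e : leftIdeal (pathClass I (QPath.trivial p.target)) :=
    ⟨_, Submodule.mem_span_singleton_self _⟩
  refine ⟨ψ e, fun ⟨y, hy⟩ => ?_⟩
  obtain ⟨b, rfl⟩ := Submodule.mem_span_singleton.1 hy.1
  change ψ ⟨b * _, hy.1⟩ = (b * _) • ψ e
  rw [← map_smul]
  congr 1
  refine Subtype.ext ?_
  change b * _ = b * _ * _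
  rw [mul_assoc, pathClass_trivial_mul_self]

theorem extVanishing_pathSyzygy {p : QPath V}
    (h : ExtVanishing (BoundQuiverAlgebra I) (leftIdeal (pathClass I p))) :
    ExtVanishing (BoundQuiverAlgebra I) (pathSyzygy I p) := by
  obtain ⟨g, hg, hex, -⟩ := exists_shortExact_pathSyzygy (I := I) p
  exact h.kernel (Submodule.inclusion_injective _) hg hex

/-! ### The paths in `L(p)` -/

theorem exists_mem_leftAnnihilatorPaths {p w : QPath V} (hw : ¬ IsZeroPath I w)
    (h : w.source = p.target) (hz : IsZeroPath I (w.comp p h)) :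
    ∃ q ∈ leftAnnihilatorPaths I p, w ∈ QPath.leftMultiples q := by
  induction hn : w.length using Nat.strong_induction_on generalizing w with
  | _ n ih =>
    by_cases hmin : w ∈ leftAnnihilatorPaths I p
    · exact ⟨w, hmin, QPath.self_mem_leftMultiples w⟩
    · obtain ⟨q', ⟨hq', h', hz'⟩, r, hr, hr1, rfl⟩ :
          ∃ q' ∈ {q : QPath V | ¬ IsZeroPath I q ∧ ∃ h : q.source = p.target,
            IsZeroPath I (q.comp p h)}, ∃ (r : QPath V) (h : r.source = q'.target),
            r.IsNontrivial ∧ w = r.comp q' h := by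
        by_contra hc
        exact hmin ⟨⟨hw, h, hz⟩, hc⟩
      rw [QPath.length_comp] at hn
      unfold QPath.IsNontrivial at hr1
      obtain ⟨q, hq, r', hr', rfl⟩ := ih _ (by omega) hq' h' hz' rfl
      have h₁ : r.source = r'.target := by rw [hr, QPath.target_comp]
      have h₂ : (r.comp r' h₁).source = q.target := by rw [QPath.source_comp, hr']
      exact ⟨q, hq, r.comp r' h₁, h₂, QPath.comp_assoc _ _ _ _ _ _ _⟩

/-- No member of `L(p)` is a left multiple of another one. -/
theorem eq_of_mem_leftMultiples {p q q' : QPath V} (hq : q ∈ leftAnnihilatorPaths I p)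
    (hq' : q' ∈ leftAnnihilatorPaths I p) (h : q' ∈ QPath.leftMultiples q) : q' = q := by
  obtain ⟨r, hr, rfl⟩ := h
  by_cases hr1 : r.IsNontrivial
  · exact absurd ⟨q, hq.1, r, hr, hr1, rfl⟩ hq'.2
  · obtain ⟨c, rfl⟩ : ∃ c, r = QPath.trivial c :=
      ⟨_, r.eq_trivial_of_length_eq_zero (by unfold QPath.IsNontrivial at hr1; omega)⟩
    exact QPath.trivial_comp c q hr

/-- The first extension group of `A p` by `A` obstructs the existence of two paths `q ≠ q'` in
`L(p)`: the projection of the syzygy of `A p` onto its direct summand `A q` would be the right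
multiplication by an element `x`, and `q x = q` and `q' x = 0` would force the coefficient in `x` of
the trivial path to be both one and zero. -/
theorem leftAnnihilatorPaths_subsingleton (hI : IsMonomial I) {p : QPath V}
    (h : ExtVanishing (BoundQuiverAlgebra I) (leftIdeal (pathClass I p))) :
    (leftAnnihilatorPaths I p).Subsingleton := by
  intro q hq q' hq'
  by_contra hne
  have hlin (b a : BoundQuiverAlgebra I) (ha : a ∈ pathSyzygy I p) :
      pathProj hI (QPath.leftMultiples q) (b * a) = b * pathProj hI (QPath.leftMultiples q) a := by
    refine pathProj_mul_left hI (fun w hw hwa r hr hz => ⟨?_, ?_⟩) b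
    · rintro ⟨r', hr', e⟩
      rcases le_total q.length w.length with hl | hl
      · obtain ⟨z, hzs, -, rfl, -⟩ := QPath.exists_comp_of_comp_eq_comp e.symm hl
        exact ⟨z, hzs, rfl⟩
      · obtain ⟨z, hzs, -, hqz, -⟩ := QPath.exists_comp_of_comp_eq_comp e hl
        have hs := source_eq_of_coef_ne_zero hI ha.1 hwa
        by_cases hz1 : z.IsNontrivial
        · exact absurd ⟨w, ⟨hw, hs, isZeroPath_comp_of_mul_eq_zero hI ha.2 hwa hs⟩, z, hzs, hz1,
            hqz⟩ hq.2
        · obtain ⟨c, rfl⟩ : ∃ c, z = QPath.trivial c :=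
            ⟨_, z.eq_trivial_of_length_eq_zero (by unfold QPath.IsNontrivial at hz1; omega)⟩
          rw [QPath.trivial_comp] at hqz
          exact hqz ▸ QPath.self_mem_leftMultiples w
    · rintro ⟨r', hr', rfl⟩
      have h₁ : r.source = r'.target := by rw [hr, QPath.target_comp]
      have h₂ : (r.comp r' h₁).source = q.target := by rw [QPath.source_comp, hr']
      exact ⟨r.comp r' h₁, h₂, QPath.comp_assoc _ _ _ _ _ _ _⟩
  obtain ⟨x, hx⟩ := exists_eq_mul_of_extVanishing h
    { toFun := fun y => pathProj hI (QPath.leftMultiples q) y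
      map_add' := fun y z => map_add _ _ _
      map_smul' := fun b y => hlin b y y.2 }
  have hxq : pathProj hI (QPath.leftMultiples q) (pathClass I q) = pathClass I q * x :=
    hx ⟨_, pathClass_mem_pathSyzygy hq.1.2.choose hq.1.2.choose_spec⟩
  have hxq' : pathProj hI (QPath.leftMultiples q) (pathClass I q') = pathClass I q' * x :=
    hx ⟨_, pathClass_mem_pathSyzygy hq'.1.2.choose hq'.1.2.choose_spec⟩
  rw [pathProj_of_mem hI (QPath.self_mem_leftMultiples q)] at hxq
  rw [pathProj_of_notMem hI fun h => hne (eq_of_mem_leftMultiples hq hq' h).symm] at hxq'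
  have h₁ := coef_pathClass_mul_self hI hq.1.1 x
  rw [← hxq, coef_self hI hq.1.1, hq.1.2.choose] at h₁
  have h₂ := coef_pathClass_mul_self hI hq'.1.1 x
  rw [← hxq', map_zero, hq'.1.2.choose, ← h₁] at h₂
  exact zero_ne_one h₂

theorem leftAnnihilatorPaths_nonempty (hI : IsMonomial I) {p : QPath V}
    (h : ¬ Module.Projective (BoundQuiverAlgebra I) (leftIdeal (pathClass I p))) :
    (leftAnnihilatorPaths I p).Nonempty := by
  by_contra hem
  obtain ⟨e⟩ := leftIdeal_equiv (a := pathClass I (QPath.trivial p.target))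
    (c := pathClass I p) fun b => ⟨fun hb => by
      rw [← trivial_mul_pathClass, ← mul_assoc, hb, zero_mul], fun hb => by
      refine eq_zero_of_coef hI fun w hw => ?_
      by_contra hc
      have hs := source_eq_of_coef_ne_zero hI (mul_mem_leftIdeal _ _) hc
      obtain ⟨q, hq, -⟩ := exists_mem_leftAnnihilatorPaths hw hs
        (isZeroPath_comp_of_mul_eq_zero hI
          (by rw [mul_assoc, trivial_mul_pathClass, hb]) hc hs)
      exact hem ⟨q, hq⟩⟩
  exact h (Module.Projective.of_equiv e)

/-- If every nonzero path `w` with `w p = 0` is a left multiple of `q`, then the syzygy of `A p` is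
`A q`. -/
theorem pathSyzygy_eq (hI : IsMonomial I) {p q : QPath V} (hs : q.source = p.target)
    (hz : IsZeroPath I (q.comp p hs))
    (h : ∀ (w : QPath V) (h : w.source = p.target), ¬ IsZeroPath I w →
      IsZeroPath I (w.comp p h) → w ∈ QPath.leftMultiples q) :
    pathSyzygy I p = leftIdeal (pathClass I q) := by
  refine le_antisymm (fun a ha => ?_) ?_
  · refine mem_of_coef hI (N := (leftIdeal (pathClass I q)).restrictScalars k) fun w hw hwa => ?_
    have hs' := source_eq_of_coef_ne_zero hI ha.1 hwa
    obtain ⟨r, hr, rfl⟩ := h w hs' hw (isZeroPath_comp_of_mul_eq_zero hI ha.2 hwa hs')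
    rw [← pathClass_mul hr]
    exact mul_mem_leftIdeal _ _
  · rw [leftIdeal, Submodule.span_singleton_le_iff_mem]
    exact pathClass_mem_pathSyzygy hs hz

/-! ### From vanishing extensions to perfect paths -/

variable (I) in
/-- A nonzero nontrivial path `p` such that all higher extensions of `A p` by `A` vanish, and such
that all maps `A p → A` are right multiplications. These paths turn out to be the perfect ones. -/
structure IsExtPerfect (p : QPath V) : Prop where
  nonzero : ¬ IsZeroPath I p
  nontrivial : p.IsNontrivial
  theta_surjective : Function.Surjective (theta (pathClass I p))
  extVanishing : ExtVanishing (BoundQuiverAlgebra I) (leftIdeal (pathClass I p))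

theorem not_projective_of_theta_surjective (hI : IsMonomial I) {p : QPath V}
    (hp : ¬ IsZeroPath I p) (hp1 : p.IsNontrivial)
    (h : Function.Surjective (theta (pathClass I p))) :
    ¬ Module.Projective (BoundQuiverAlgebra I) (leftIdeal (pathClass I p)) := by
  intro hproj
  obtain ⟨t, ht⟩ := exists_mul_mul_eq_self h hproj
  have h₁ := coef_self hI hp
  -- every path that occurs in `p t p` is longer than `p`
  have h₂ := coef_mul_pathClass_of_forall_ne hI (p := p) (w := QPath.trivial p.source)
    (fun q h e => by
      have := congrArg QPath.length e
      rw [QPath.length_comp] at this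
      exact absurd hp1 (by
        unfold QPath.IsNontrivial
        change _ = 0 at this
        omega)) t
  rw [← ht, mul_assoc, coef_pathClass_mul_self hI hp, h₂] at h₁
  exact zero_ne_one h₁

/-- If `A p` is not projective and has no higher extensions by `A`, then `L(p)` consists of one path
`q`, and `q` has the same properties. -/
theorem exists_leftAnnihilatorPaths_eq_singleton (hI : IsMonomial I) {p : QPath V}
    (hp : ¬ IsZeroPath I p)
    (hproj : ¬ Module.Projective (BoundQuiverAlgebra I) (leftIdeal (pathClass I p)))
    (h : ExtVanishing (BoundQuiverAlgebra I) (leftIdeal (pathClass I p))) :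
    ∃ q, leftAnnihilatorPaths I p = {q} ∧ pathSyzygy I p = leftIdeal (pathClass I q) ∧
      IsExtPerfect I q := by
  obtain ⟨q, hq⟩ := leftAnnihilatorPaths_nonempty hI hproj
  have hL := (leftAnnihilatorPaths_subsingleton hI h).eq_singleton_of_mem hq
  obtain ⟨hq0, hs, hz⟩ := hq.1
  have hK : pathSyzygy I p = leftIdeal (pathClass I q) := by
    refine pathSyzygy_eq hI hs hz fun w hws hw hwz => ?_
    obtain ⟨q', hq', hwq'⟩ := exists_mem_leftAnnihilatorPaths hw hws hwz
    rw [hL] at hq'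
    exact hq' ▸ hwq'
  refine ⟨q, hL, hK, hq0, ?_, ?_, ?_⟩
  · by_contra hq1
    obtain ⟨c, rfl⟩ : ∃ c, q = QPath.trivial c :=
      ⟨_, q.eq_trivial_of_length_eq_zero (by unfold QPath.IsNontrivial at hq1; omega)⟩
    rw [QPath.trivial_comp] at hz
    exact hp hz
  · refine theta_surjective_iff.2 fun f => ?_
    obtain ⟨x, hx⟩ := exists_eq_mul_of_extVanishing h
      (f ∘ₗ (LinearEquiv.ofEq _ _ hK).toLinearMap)
    exact ⟨x, fun ⟨y, hy⟩ => hx ⟨y, hK ▸ hy⟩⟩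
  · rw [← hK]
    exact extVanishing_pathSyzygy h

theorem IsExtPerfect.exists_isPerfectPair (hI : IsMonomial I) {p : QPath V}
    (h : IsExtPerfect I p) : ∃ q, IsPerfectPair I q p ∧ IsExtPerfect I q := by
  obtain ⟨q, hL, hK, hq⟩ := exists_leftAnnihilatorPaths_eq_singleton hI h.nonzero
    (not_projective_of_theta_surjective hI h.nonzero h.nontrivial h.theta_surjective)
    h.extVanishing
  have hqL : q ∈ leftAnnihilatorPaths I p := hL ▸ rfl
  refine ⟨q, ⟨hq.nonzero, h.nonzero, hq.nontrivial, h.nontrivial, hqL.1.2, ?_, ?_⟩, hq⟩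
  · intro q' hs hq' hz
    -- right multiplication by `q'` kills the syzygy `A q` of `A p`, so it factors through `A p`
    obtain ⟨f, hf⟩ := exists_leftIdeal_hom (a := pathClass I p) (c := pathClass I q') fun b hb => by
      have hb' : b * pathClass I (QPath.trivial p.target) ∈ leftIdeal (pathClass I q) := by
        rw [← hK]
        exact ⟨mul_mem_leftIdeal _ _, by
          change b * _ * _ = 0
          rw [mul_assoc, trivial_mul_pathClass, hb]⟩
      obtain ⟨c, hc⟩ := Submodule.mem_span_singleton.1 hb'
      have ht : p.target = q'.target := by rw [← hqL.1.2.choose, hs]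
      rw [← trivial_mul_pathClass q', ← mul_assoc, ← ht, ← hc, smul_eq_mul, mul_assoc,
        pathClass_mul hs, pathClass_eq_zero_iff.2 hz, mul_zero]
    obtain ⟨t, ht⟩ := theta_surjective_iff.1 h.theta_surjective f
    have h₁ : pathClass I q' = pathClass I p * t := by
      have h₂ := hf 1 (mul_mem_leftIdeal _ _)
      rw [ht] at h₂
      change 1 * pathClass I p * t = 1 * pathClass I q' at h₂
      rw [one_mul, one_mul] at h₂
      exact h₂.symm
    by_contra hne
    have h₂ := coef_self hI hq'
    rw [h₁, coef_pathClass_mul_of_forall_ne hI fun r hr e => hne ⟨r, hr, e.symm⟩] at h₂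
    exact zero_ne_one h₂
  · intro p' hs hp' hz
    obtain ⟨q', hq', r, hr, rfl⟩ := exists_mem_leftAnnihilatorPaths hp' hs hz
    obtain rfl : q' = q := by rwa [hL] at hq'
    exact ⟨r, hr, rfl⟩

theorem IsPerfectPair.right_unique_eq {p q q' : QPath V} (h : IsPerfectPair I p q)
    (h' : IsPerfectPair I p q') : q = q' := by
  obtain ⟨r, hr, e⟩ := h.right_unique q' h'.mul_eq_zero.choose h'.right_nonzero
    h'.mul_eq_zero.choose_spec
  obtain ⟨r', hr', e'⟩ := h'.right_unique q h.mul_eq_zero.choose h.right_nonzero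
    h.mul_eq_zero.choose_spec
  have hl := congrArg QPath.length e
  have hl' := congrArg QPath.length e'
  rw [QPath.length_comp] at hl hl'
  obtain ⟨c, rfl⟩ : ∃ c, r = QPath.trivial c :=
    ⟨_, r.eq_trivial_of_length_eq_zero (by omega)⟩
  rw [e, QPath.comp_trivial]

/-- A backward orbit of a partial function inside a finite set is periodic. -/
theorem exists_eq_of_finite_range {α : Type*} {R : α → α → Prop}
    (hR : ∀ a b c, R a b → R a c → b = c) {s : Set α} (hs : s.Finite) (f : ℕ → α)
    (hf : ∀ n, f n ∈ s) (h : ∀ n, R (f (n + 1)) (f n)) : ∃ n, 1 ≤ n ∧ f n = f 0 := by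
  have hdesc (i n : ℕ) (e : f (i + n) = f i) : f n = f 0 := by
    induction i with
    | zero => rwa [zero_add] at e
    | succ i ih =>
      refine ih (hR _ _ _ (h _) ?_)
      rw [show i + n + 1 = i + 1 + n by omega, e]
      exact h i
  have : ¬ Function.Injective f := fun hinj =>
    Set.infinite_of_injective_forall_mem hinj hf hs
  simp only [Function.Injective, not_forall] at this
  obtain ⟨i, j, e, hij⟩ := this
  rcases lt_or_gt_of_ne hij with hlt | hlt
  · exact ⟨j - i, by omega, hdesc i _ (by rw [Nat.add_sub_cancel' hlt.le, e])⟩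
  · exact ⟨i - j, by omega, hdesc j _ (by rw [Nat.add_sub_cancel' hlt.le, e])⟩

variable [∀ a b : V, Finite (a ⟶ b)]

theorem IsExtPerfect.isPerfectPath (hI : IsMonomial I) {p : QPath V} (h : IsExtPerfect I p) :
    IsPerfectPath I p := by
  choose! g hg hg' using fun p (hp : IsExtPerfect I p) => hp.exists_isPerfectPair hI
  have hit (n : ℕ) : IsExtPerfect I (g^[n] p) := by
    induction n with
    | zero => exact h
    | succ n ih =>
      rw [Function.iterate_succ_apply']
      exact hg' _ ih
  have hpair (n : ℕ) : IsPerfectPair I (g^[n + 1] p) (g^[n] p) := by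
    rw [Function.iterate_succ_apply']
    exact hg _ (hit n)
  obtain ⟨n, hn, e⟩ := exists_eq_of_finite_range (R := IsPerfectPair I)
    (fun a b c hb hc => hb.right_unique_eq hc) hI.finite_nonzero_paths (fun n => g^[n] p)
    (fun n => (hit n).nonzero) hpair
  refine ⟨n, fun i => g^[n - i] p, hn, e, by simp, fun i hi => ?_⟩
  have := hpair (n - (i + 1))
  rwa [show n - (i + 1) + 1 = n - i by omega] at this

end Monomial

section Monomial

variable {k : Type w} [Field k] {V : Type u} [Quiver.{v} V] [DecidableEq V] [Fintype V]
variable {I : TwoSidedIdeal (PathAlgebra k V)}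

/-! ### Indecomposable second syzygies -/

theorem not_isZeroPath_of_coef_ne_zero (hI : IsMonomial I) {p : QPath V}
    {a : BoundQuiverAlgebra I} (h : coef hI p a ≠ 0) : ¬ IsZeroPath I p := fun hp =>
  h (by rw [coef, dif_pos hp, LinearMap.zero_apply])

/-- The coefficient in a product `a b` of a path of the least length in the support of `a`. -/
theorem coef_mul_of_forall_le (hI : IsMonomial I) {p : QPath V} (hp : ¬ IsZeroPath I p)
    {a : BoundQuiverAlgebra I} (ha : ∀ q, coef hI q a ≠ 0 → p.length ≤ q.length)
    (b : BoundQuiverAlgebra I) :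
    coef hI p (a * b) = coef hI (QPath.trivial p.source) b * coef hI p a := by
  suffices H : a ∈ LinearMap.eqLocus (coef hI p ∘ₗ LinearMap.mulRight k b)
      (coef hI (QPath.trivial p.source) b • coef hI p) from H
  refine mem_of_coef hI fun q hq hqa => ?_
  change coef hI p (pathClass I q * b) =
    coef hI (QPath.trivial p.source) b * coef hI p (pathClass I q)
  by_cases hqp : q = p
  · subst hqp
    rw [coef_pathClass_mul_self hI hq, coef_self hI hq, mul_one]
  · rw [coef_of_ne hI hqp, mul_zero, coef_pathClass_mul_of_forall_ne]
    intro r hr e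
    have hl := congrArg QPath.length e
    rw [QPath.length_comp] at hl
    obtain ⟨c, rfl⟩ : ∃ c, r = QPath.trivial c :=
      ⟨_, r.eq_trivial_of_length_eq_zero (by have := ha q hqa; omega)⟩
    exact hqp (by rw [← e, QPath.comp_trivial])

theorem pathProj_leftMultiples_mul (hI : IsMonomial I) {p : QPath V} {a : BoundQuiverAlgebra I}
    (ha : ∀ q, coef hI q a ≠ 0 → p.length ≤ q.length) (b : BoundQuiverAlgebra I) :
    pathProj hI (QPath.leftMultiples p) (b * a) = b * pathProj hI (QPath.leftMultiples p) a := by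
  refine pathProj_mul_left hI (fun q hq hqa r hr hz => ⟨?_, ?_⟩) b
  · rintro ⟨r', hr', e⟩
    obtain ⟨z, hzs, -, rfl, -⟩ := QPath.exists_comp_of_comp_eq_comp e.symm (ha q hqa)
    exact ⟨z, hzs, rfl⟩
  · rintro ⟨r', hr', rfl⟩
    have h₁ : r.source = r'.target := by rw [hr, QPath.target_comp]
    have h₂ : (r.comp r' h₁).source = p.target := by rw [QPath.source_comp, hr']
    exact ⟨r.comp r' h₁, h₂, QPath.comp_assoc _ _ _ _ _ _ _⟩

theorem pathProj_mul_rightMultiples (hI : IsMonomial I) {p : QPath V} {a : BoundQuiverAlgebra I}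
    (ha : ∀ q, coef hI q a ≠ 0 → p.length ≤ q.length) (b : BoundQuiverAlgebra I) :
    pathProj hI (QPath.rightMultiples p) (a * b) =
      pathProj hI (QPath.rightMultiples p) a * b := by
  refine pathProj_mul_right hI (fun q hq hqa r hr hz => ⟨?_, ?_⟩) b
  · rintro ⟨r', hr', e⟩
    have hl := congrArg QPath.length e
    rw [QPath.length_comp, QPath.length_comp] at hl
    obtain ⟨z, -, hzs, -, rfl⟩ :=
      QPath.exists_comp_of_comp_eq_comp e (by have := ha q hqa; omega)
    exact ⟨z, hzs, rfl⟩
  · rintro ⟨r', hr', rfl⟩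
    have h₁ : r'.source = r.target := by rw [← hr, QPath.source_comp]
    have h₂ : p.source = (r'.comp r h₁).target := by rw [QPath.target_comp, hr']
    exact ⟨r'.comp r h₁, h₂, (QPath.comp_assoc _ _ _ _ _ _ _).symm⟩

theorem pathProj_leftMultiples_mem (hI : IsMonomial I) (p : QPath V)
    (a : BoundQuiverAlgebra I) :
    pathProj hI (QPath.leftMultiples p) a ∈ leftIdeal (pathClass I p) := by
  refine pathProj_mem hI (N := (leftIdeal (pathClass I p)).restrictScalars k) ?_ a
  rintro _ ⟨r, h, rfl⟩
  rw [← pathClass_mul h]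
  exact mul_mem_leftIdeal _ _

theorem exists_pathProj_rightMultiples_eq (hI : IsMonomial I) (p : QPath V)
    (a : BoundQuiverAlgebra I) :
    ∃ b, pathProj hI (QPath.rightMultiples p) a = pathClass I p * b := by
  obtain ⟨b, hb⟩ := pathProj_mem hI (S := QPath.rightMultiples p)
    (N := LinearMap.range (LinearMap.mulLeft k (pathClass I p))) (by
      rintro _ ⟨r, h, rfl⟩
      exact ⟨pathClass I r, pathClass_mul h⟩) a
  exact ⟨b, hb.symm⟩

theorem mem_leftMultiples_of_coef_ne_zero (hI : IsMonomial I) {p q : QPath V}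
    {a : BoundQuiverAlgebra I} (ha : a ∈ leftIdeal (pathClass I p)) (hq : coef hI q a ≠ 0) :
    q ∈ QPath.leftMultiples p := by
  obtain ⟨b, rfl⟩ := Submodule.mem_span_singleton.1 ha
  by_contra h
  exact hq (coef_mul_pathClass_of_forall_ne hI (fun r hr e => h ⟨r, hr, e⟩) b)

theorem exists_coef_ne_zero_forall_le (hI : IsMonomial I) {S : Set (BoundQuiverAlgebra I)}
    {a : BoundQuiverAlgebra I} (ha : a ∈ S) (ha0 : a ≠ 0) :
    ∃ b ∈ S, ∃ p, coef hI p b ≠ 0 ∧ ∀ c ∈ S, ∀ q, coef hI q c ≠ 0 → p.length ≤ q.length := by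
  classical
  have h : ∃ n, ∃ b ∈ S, ∃ p, coef hI p b ≠ 0 ∧ p.length = n := by
    by_contra hc
    push Not at hc
    refine ha0 (eq_zero_of_coef hI fun p hp => ?_)
    by_contra hpa
    exact hc _ a ha p hpa rfl
  obtain ⟨b, hb, p, hp, hn⟩ := Nat.find_spec h
  exact ⟨b, hb, p, hp, fun c hc q hq => hn ▸ Nat.find_min' h ⟨c, hc, q, hq, rfl⟩⟩

variable [∀ a b : V, Finite (a ⟶ b)]

/-- An indecomposable submodule `K` of a free module that is cut out by linear functionals is
isomorphic to `A p` for a path `p`; see B. Huisgen-Zimmermann's description of second syzygies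
over monomial algebras.

For `p`, take a shortest path that occurs in a coordinate `j` of some `a ∈ K`. Discarding all
the paths in the coordinates of `a` that do not begin (on the left) with `p` leaves an element
`(p f_i)_i` of `K`, so that there is a map `A p → K` with `y ↦ (y f_i)_i`. In the other direction,
one projects the `j`-th coordinate to the paths that end with `p`. The composite is an injective
endomorphism of `A p`, so that `A p` is a direct summand of `K`. -/
theorem exists_equiv_leftIdeal_of_isIndecomposable (hI : IsMonomial I) {n : ℕ}
    (K : Submodule (BoundQuiverAlgebra I) (Fin n → BoundQuiverAlgebra I))
    (hK : ∀ a, (∀ t : (Fin n → BoundQuiverAlgebra I) →ₗ[BoundQuiverAlgebra I]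
      BoundQuiverAlgebra I, (∀ b ∈ K, t b = 0) → t a = 0) → a ∈ K)
    (hind : IsIndecomposableModule (BoundQuiverAlgebra I) K) :
    ∃ p, ¬ IsZeroPath I p ∧
      Nonempty (K ≃ₗ[BoundQuiverAlgebra I] leftIdeal (pathClass I p)) := by
  have := hind.1
  obtain ⟨⟨a₀, ha₀⟩, hne⟩ := exists_ne (0 : K)
  obtain ⟨j₀, hj₀⟩ : ∃ j, a₀ j ≠ 0 := by
    by_contra hc
    push Not at hc
    exact hne (Subtype.ext (funext hc))
  obtain ⟨_, ⟨a, ha, j, rfl⟩, p, hp, hmin⟩ := exists_coef_ne_zero_forall_le hI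
    (S := {b | ∃ a ∈ K, ∃ j, a j = b}) ⟨a₀, ha₀, j₀, rfl⟩ hj₀
  have hp0 := not_isZeroPath_of_coef_ne_zero hI hp
  have hlong (b) (hb : b ∈ K) (i) (q) (hq : coef hI q (b i) ≠ 0) : p.length ≤ q.length :=
    hmin _ ⟨b, hb, i, rfl⟩ q hq
  choose f hf using fun i => exists_pathProj_rightMultiples_eq hI p (a i)
  have hs : (fun i => pathClass I p * f i) ∈ K := by
    refine hK _ fun t ht => ?_
    have ht' (b : Fin n → BoundQuiverAlgebra I) :
        t b = ∑ i, b i * t (fun j => if i = j then 1 else 0) :=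
      LinearMap.pi_apply_eq_sum_univ t b
    have h₀ := congrArg (pathProj hI (QPath.rightMultiples p)) (ht a ha)
    rw [ht', map_sum, map_zero] at h₀
    rw [ht']
    refine Eq.trans ?_ h₀
    refine Finset.sum_congr rfl fun i _ => ?_
    rw [pathProj_mul_rightMultiples hI (hlong a ha i), hf]
  let φ : leftIdeal (pathClass I p) →ₗ[BoundQuiverAlgebra I] K :=
    (LinearMap.pi fun i => (LinearMap.toSpanSingleton _ (BoundQuiverAlgebra I) (f i)).comp
      (Submodule.subtype _)).codRestrict K (by
        rintro ⟨y, hy⟩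
        obtain ⟨b, rfl⟩ := Submodule.mem_span_singleton.1 hy
        convert K.smul_mem b hs using 1
        funext i
        exact mul_assoc _ _ _)
  let ρ : K →ₗ[BoundQuiverAlgebra I] leftIdeal (pathClass I p) :=
    { toFun := fun b => ⟨_, pathProj_leftMultiples_mem hI p (b.1 j)⟩
      map_add' := fun b c => Subtype.ext (map_add _ _ _)
      map_smul' := fun r b =>
        Subtype.ext (pathProj_leftMultiples_mul hI (hlong b.1 b.2 j) r) }
  have hinj : Function.Injective (ρ ∘ₗ φ) := by
    rw [← LinearMap.ker_eq_bot, LinearMap.ker_eq_bot']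
    rintro ⟨y, hy⟩ hy0
    have hy0' : pathProj hI (QPath.leftMultiples p) (y * f j) = 0 := congrArg Subtype.val hy0
    by_contra hne
    obtain ⟨y', hy', q, hq, hqmin⟩ := exists_coef_ne_zero_forall_le hI (Set.mem_singleton y)
      fun h => hne (Subtype.ext h)
    rw [Set.mem_singleton_iff.1 hy'] at hq
    have hqp := mem_leftMultiples_of_coef_ne_zero hI hy hq
    have hqs : q.source = p.source := by
      obtain ⟨r, hr, rfl⟩ := hqp
      exact QPath.source_comp _ _ _
    have h₁ := coef_pathProj hI hqp (y * f j)
    rw [hy0', map_zero, coef_mul_of_forall_le hI (not_isZeroPath_of_coef_ne_zero hI hq)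
      (hqmin y rfl), hqs, ← coef_pathClass_mul_self hI hp0, ← hf,
      coef_pathProj hI (QPath.self_mem_rightMultiples p)] at h₁
    exact mul_ne_zero hp hq h₁.symm
  have := hI.module_finite
  have : IsArtinian (BoundQuiverAlgebra I) (BoundQuiverAlgebra I) :=
    isArtinian_of_tower k inferInstance
  have hsurj := IsArtinian.surjective_of_injective_endomorphism _ hinj
  have hcompl : IsCompl (LinearMap.range φ) (LinearMap.ker ρ) := by
    refine IsCompl.of_eq ?_ ?_
    · rw [eq_bot_iff]
      rintro _ ⟨⟨y, rfl⟩, hy⟩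
      have : y = 0 := hinj (by rw [map_zero]; exact hy)
      rw [this, map_zero]
      exact zero_mem _
    · rw [eq_top_iff]
      intro b _
      obtain ⟨y, hy⟩ := hsurj (ρ b)
      refine Submodule.mem_sup.2 ⟨φ y, ⟨y, rfl⟩, b - φ y, ?_, add_sub_cancel _ _⟩
      rw [LinearMap.mem_ker, map_sub, ← hy, LinearMap.comp_apply, sub_self]
  rcases hind.2 _ _ hcompl with h | h
  · have h₁ : (⟨pathClass I p, Submodule.mem_span_singleton_self _⟩ : leftIdeal (pathClass I p)) =
        0 := hinj (by rw [LinearMap.comp_apply, LinearMap.range_eq_bot.1 h, LinearMap.zero_apply,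
          map_zero, map_zero])
    exact absurd (pathClass_eq_zero_iff.1 (congrArg Subtype.val h₁)) hp0
  · exact ⟨p, hp0, ⟨LinearEquiv.ofBijective ρ ⟨LinearMap.ker_eq_bot.1 h,
      Function.Surjective.of_comp hsurj⟩⟩⟩

end Monomial

section Monomial

variable {k : Type w} [Field k] {V : Type u} [Quiver.{v} V] [DecidableEq V] [Fintype V]
variable {I : TwoSidedIdeal (PathAlgebra k V)}

/-! ### Perfect paths and their complete resolutions -/

/-- A perfect path is a member of a periodic sequence, indexed by `ℤ`, in which any two
consecutive members form a perfect pair. -/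
theorem isPerfectPath_iff {p : QPath V} : IsPerfectPath I p ↔ ∃ (n : ℕ) (σ : ℤ → QPath V),
    1 ≤ n ∧ σ 0 = p ∧ (∀ i, σ (i + n) = σ i) ∧ ∀ i, IsPerfectPair I (σ i) (σ (i + 1)) := by
  constructor
  · rintro ⟨n, s, hn, h0, h1, h⟩
    refine ⟨n, fun i => s (i % n).toNat, hn, by simpa using h0, by simp, fun i => ?_⟩
    have hn' : (0 : ℤ) < n := by exact_mod_cast hn
    have h₁ := Int.emod_nonneg i hn'.ne'
    have h₂ := Int.emod_lt_of_pos i hn'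
    have h₃ := h (i % n).toNat (by omega)
    rcases eq_or_lt_of_le (Int.add_one_le_of_lt h₂) with h₄ | h₄
    · have h₅ : (i + 1) % n = 0 := by rw [← Int.emod_add_emod, h₄, Int.emod_self]
      have h₆ : (i % n).toNat + 1 = n := by omega
      rw [h₆, h1, ← h0] at h₃
      simpa [h₅] using h₃
    · have h₅ : (i + 1) % n = i % n + 1 := by
        rw [← Int.emod_add_emod, Int.emod_eq_of_lt (by omega) h₄]
      have h₆ : (i % n + 1).toNat = (i % n).toNat + 1 := by omega
      simpa only [h₅, h₆] using h₃
  · rintro ⟨n, σ, hn, h0, h1, h⟩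
    exact ⟨n, fun i => σ i, hn, h0, by simpa [h0] using h1 0, fun i _ => by simpa using h i⟩

theorem IsPerfectPath.exists_isPerfectPair {p : QPath V} (h : IsPerfectPath I p) :
    ∃ q, IsPerfectPair I p q ∧ IsPerfectPath I q := by
  obtain ⟨n, σ, hn, rfl, h1, h2⟩ := isPerfectPath_iff.1 h
  refine ⟨σ (0 + 1), h2 0, isPerfectPath_iff.2 ⟨n, fun i => σ (i + 1), hn, rfl, fun i => ?_,
    fun i => h2 _⟩⟩
  change σ (i + n + 1) = σ (i + 1)
  rw [add_right_comm, h1]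

theorem IsPerfectPair.pathSyzygy_eq (hI : IsMonomial I) {p q : QPath V}
    (h : IsPerfectPair I p q) : pathSyzygy I q = leftIdeal (pathClass I p) :=
  _root_.pathSyzygy_eq hI h.mul_eq_zero.choose h.mul_eq_zero.choose_spec fun w hs hw hz => by
    obtain ⟨r, hr, rfl⟩ := h.left_unique w hs hw hz
    exact ⟨r, hr, rfl⟩

/-- For a perfect pair `(p, q)`, the elements of `e A` that `p` annihilates are those of `q A`. -/
theorem IsPerfectPair.exists_eq_mul (hI : IsMonomial I) {p q : QPath V} (h : IsPerfectPair I p q)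
    {z : BoundQuiverAlgebra I} (hz : pathClass I p * z = 0)
    (he : pathClass I (QPath.trivial q.target) * z = z) : ∃ t, z = pathClass I q * t := by
  have hmem : z ∈ LinearMap.range (LinearMap.mulLeft k (pathClass I q)) := by
    refine mem_of_coef hI fun w hw hwz => ?_
    have hs : p.source = w.target := by
      rw [target_eq_of_coef_ne_zero hI he hwz, h.mul_eq_zero.choose]
    obtain ⟨r, hr, rfl⟩ := h.right_unique w hs hw
      (isZeroPath_comp_of_pathClass_mul_eq_zero hI hz hwz hs)
    exact ⟨pathClass I r, pathClass_mul hr⟩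
  obtain ⟨t, ht⟩ := hmem
  exact ⟨t, ht.symm⟩

theorem IsPerfectPair.theta_surjective (hI : IsMonomial I) {p q : QPath V}
    (h : IsPerfectPair I p q) : Function.Surjective (theta (pathClass I q)) := by
  refine theta_surjective_iff.2 fun f => ?_
  have hsmul (b : BoundQuiverAlgebra I) (y : leftIdeal (pathClass I q))
      (hy : b * pathClass I q = y) :
      f y = b * f ⟨_, Submodule.mem_span_singleton_self _⟩ := by
    rw [← smul_eq_mul, ← map_smul]
    exact congrArg f (Subtype.ext hy.symm)
  obtain ⟨t, ht⟩ := h.exists_eq_mul hI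
    (z := f ⟨pathClass I q, Submodule.mem_span_singleton_self _⟩)
    (by rw [← hsmul _ 0 (by
      rw [pathClass_mul h.mul_eq_zero.choose,
        pathClass_eq_zero_iff.2 h.mul_eq_zero.choose_spec]; rfl), map_zero])
    (hsmul _ _ (trivial_mul_pathClass q)).symm
  refine ⟨t, fun ⟨y, hy⟩ => ?_⟩
  obtain ⟨b, rfl⟩ := Submodule.mem_span_singleton.1 hy
  rw [hsmul b _ rfl, ht]
  exact (mul_assoc _ _ _).symm

theorem mul_pathClass_eq_zero_iff {p : QPath V} {b : BoundQuiverAlgebra I} :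
    b * pathClass I p = 0 ↔ b * pathClass I (QPath.trivial p.target) ∈ pathSyzygy I p := by
  rw [mem_pathSyzygy, mul_assoc, trivial_mul_pathClass]
  exact ⟨fun h => ⟨mul_mem_leftIdeal _ _, h⟩, fun h => h.2⟩

/-- A two-sided sequence of paths in which any two consecutive members form a perfect pair gives a
complete resolution, whose differentials are the right multiplications by these paths. -/
theorem isGorensteinProjective_of_isPerfectPair (hI : IsMonomial I) (σ : ℤ → QPath V)
    (hσ : ∀ i, IsPerfectPair I (σ i) (σ (i + 1))) :
    IsGorensteinProjective (BoundQuiverAlgebra I) (leftIdeal (pathClass I (σ 0))) := by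
  let e (i : ℤ) : BoundQuiverAlgebra I := pathClass I (QPath.trivial (σ i).target)
  have he (i : ℤ) : e i * e i = e i := pathClass_trivial_mul_self _
  have hmul (i : ℤ) : pathClass I (σ i) * e (i + 1) = pathClass I (σ i) := by
    change _ * pathClass I (QPath.trivial (σ (i + 1)).target) = _
    rw [← (hσ i).mul_eq_zero.choose, pathClass_mul_trivial]
  have hee (i : ℤ) : e i * pathClass I (σ i) = pathClass I (σ i) := trivial_mul_pathClass _
  let d (i : ℤ) : leftIdeal (e i) →ₗ[BoundQuiverAlgebra I] leftIdeal (e (i + 1)) :=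
    ((LinearMap.toSpanSingleton _ (BoundQuiverAlgebra I) (pathClass I (σ i))).comp
      (Submodule.subtype _)).codRestrict _ fun y => by
        change (y : BoundQuiverAlgebra I) * pathClass I (σ i) ∈ _
        rw [← hmul i, ← mul_assoc]
        exact mul_mem_leftIdeal _ _
  have hd (i : ℤ) (y) : (d i y : BoundQuiverAlgebra I) = y * pathClass I (σ i) := rfl
  have hzero (i : ℤ) : pathClass I (σ i) * pathClass I (σ (i + 1)) = 0 := by
    rw [pathClass_mul (hσ i).mul_eq_zero.choose,
      pathClass_eq_zero_iff.2 (hσ i).mul_eq_zero.choose_spec]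
  have hker (i : ℤ) (y : leftIdeal (e (i + 1))) :
      d (i + 1) y = 0 ↔ (y : BoundQuiverAlgebra I) ∈ leftIdeal (pathClass I (σ i)) := by
    rw [← (hσ i).pathSyzygy_eq hI, mem_pathSyzygy, Subtype.ext_iff, hd]
    exact ⟨fun h => ⟨y.2, h⟩, fun h => h.2⟩
  -- a map `A e → A` is the right multiplication by the image of `e`
  have hhom (i : ℤ) (f : leftIdeal (e i) →ₗ[BoundQuiverAlgebra I] BoundQuiverAlgebra I)
      (b : BoundQuiverAlgebra I) (y : leftIdeal (e i)) (hy : b * e i = y) :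
      f y = b * f ⟨e i, Submodule.mem_span_singleton_self _⟩ := by
    rw [← smul_eq_mul, ← map_smul]
    exact congrArg f (Subtype.ext hy.symm)
  refine ⟨fun i => ModuleCat.of _ (leftIdeal (e i)), d, fun i => ⟨?_, ?_⟩, fun i => ?_,
    fun i => ?_, 0 + 1, ⟨?_⟩⟩
  · exact inferInstanceAs (Module.Finite _ (leftIdeal (e i)))
  · exact projective_leftIdeal (he i)
  · intro y
    rw [hker]
    constructor
    · intro hy
      obtain ⟨b, hb⟩ := Submodule.mem_span_singleton.1 hy
      refine ⟨⟨b * e i, mul_mem_leftIdeal _ _⟩, Subtype.ext ?_⟩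
      rw [hd, ← hb, mul_assoc, hee]
      rfl
    · rintro ⟨z, rfl⟩
      rw [hd]
      exact mul_mem_leftIdeal _ _
  · intro f
    constructor
    · intro hf
      obtain ⟨t, ht⟩ := (hσ i).exists_eq_mul hI
        (z := f ⟨e (i + 1), Submodule.mem_span_singleton_self _⟩)
        (by
          have h := LinearMap.congr_fun hf ⟨e i, Submodule.mem_span_singleton_self _⟩
          rw [← hhom (i + 1) f (pathClass I (σ i))
            (d i ⟨e i, Submodule.mem_span_singleton_self _⟩)]
          · exact h
          · rw [hmul, hd, hee])
        (hhom (i + 1) f _ _ (he _)).symm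
      refine ⟨(LinearMap.toSpanSingleton _ (BoundQuiverAlgebra I) t).comp
        (Submodule.subtype _), LinearMap.ext fun ⟨y, hy⟩ => ?_⟩
      obtain ⟨b, rfl⟩ := Submodule.mem_span_singleton.1 hy
      rw [hhom (i + 1) f b _ rfl, ht]
      change b * e (i + 1) * pathClass I (σ (i + 1)) * t = _
      rw [mul_assoc b, hee, mul_assoc]
    · rintro ⟨g, rfl⟩
      refine LinearMap.ext fun y => ?_
      have h : d (i + 1) (d i y) = 0 := Subtype.ext (by
        rw [hd, hd, mul_assoc, hzero, mul_zero]; rfl)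
      change g (d (i + 1) (d i y)) = 0
      rw [h, map_zero]
  · refine ((Submodule.equivSubtypeMap (leftIdeal (e (0 + 1))) (LinearMap.ker (d (0 + 1)))).trans
      (LinearEquiv.ofEq _ _ ?_)).symm
    ext y
    constructor
    · rintro ⟨z, hz, rfl⟩
      exact (hker 0 z).1 hz
    · intro hy
      have hle : leftIdeal (pathClass I (σ 0)) ≤ leftIdeal (e (0 + 1)) := by
        rw [← (hσ 0).pathSyzygy_eq hI]
        exact pathSyzygy_le _
      exact ⟨⟨y, hle hy⟩, (hker 0 _).2 hy, rfl⟩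

theorem IsPerfectPath.isGorensteinProjective (hI : IsMonomial I) {p : QPath V}
    (h : IsPerfectPath I p) :
    ¬ Module.Projective (BoundQuiverAlgebra I) (leftIdeal (pathClass I p)) ∧
      IsGorensteinProjective (BoundQuiverAlgebra I) (leftIdeal (pathClass I p)) := by
  obtain ⟨n, σ, -, rfl, -, hσ⟩ := isPerfectPath_iff.1 h
  refine ⟨?_, isGorensteinProjective_of_isPerfectPair hI σ hσ⟩
  have h' := hσ (-1)
  rw [neg_add_cancel] at h'
  exact not_projective_of_theta_surjective hI h'.right_nonzero h'.right_nontrivial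
    (h'.theta_surjective hI)

variable [∀ a b : V, Finite (a ⟶ b)]

/-- If `A p` is not projective and has no higher extensions by `A`, then it is isomorphic to `A q`
for a perfect path `q`: its syzygy is `A q'` for a perfect path `q'`, and the perfect path `q` that
follows `q'` has the same syzygy. -/
theorem exists_isPerfectPath_equiv (hI : IsMonomial I) {p : QPath V} (hp : ¬ IsZeroPath I p)
    (hproj : ¬ Module.Projective (BoundQuiverAlgebra I) (leftIdeal (pathClass I p)))
    (h : ExtVanishing (BoundQuiverAlgebra I) (leftIdeal (pathClass I p))) :
    ∃ q, IsPerfectPath I q ∧ Nonempty (leftIdeal (pathClass I p) ≃ₗ[BoundQuiverAlgebra I]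
      leftIdeal (pathClass I q)) := by
  obtain ⟨q', hL, hK, hq'⟩ := exists_leftAnnihilatorPaths_eq_singleton hI hp hproj h
  obtain ⟨q, hpair, hq⟩ := (hq'.isPerfectPath hI).exists_isPerfectPair
  have hqL : q' ∈ leftAnnihilatorPaths I p := hL ▸ rfl
  refine ⟨q, hq, leftIdeal_equiv fun b => ?_⟩
  rw [mul_pathClass_eq_zero_iff, mul_pathClass_eq_zero_iff, hK, hpair.pathSyzygy_eq hI,
    ← hqL.1.2.choose, ← hpair.mul_eq_zero.choose]

end Monomial

theorem proposition4p3 {k : Type w} [Field k] {V : Type u} [Quiver.{v} V] [DecidableEq V]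
    [Fintype V] [∀ a b : V, Finite (a ⟶ b)]
    (I : TwoSidedIdeal (PathAlgebra k V)) (hI : IsMonomial I) :
    (∀ p : QPath V, ¬ IsZeroPath I p → p.IsNontrivial →
      Function.Bijective (theta (pathClass I p)) →
      ¬ Module.Projective (BoundQuiverAlgebra I) (leftIdeal (pathClass I p)) →
      IsGorensteinProjective (BoundQuiverAlgebra I) (leftIdeal (pathClass I p)) →
      IsPerfectPath I p) ∧
    (∀ p : QPath V, ¬ IsZeroPath I p → p.IsNontrivial →
      ¬ Module.Projective (BoundQuiverAlgebra I) (leftIdeal (pathClass I p)) →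
      IsGorensteinProjective (BoundQuiverAlgebra I) (leftIdeal (pathClass I p)) →
      ∃! q : QPath V, IsPerfectPath I q ∧ leftAnnihilatorPaths I p = {q}) ∧
    (∀ (M : Type x) [AddCommGroup M] [Module (BoundQuiverAlgebra I) M],
      IsIndecomposableModule (BoundQuiverAlgebra I) M →
      ¬ Module.Projective (BoundQuiverAlgebra I) M →
      IsGorensteinProjective (BoundQuiverAlgebra I) M →
      ∃ q : QPath V, IsPerfectPath I q ∧
        Nonempty (M ≃ₗ[BoundQuiverAlgebra I] leftIdeal (pathClass I q))) ∧
    (∀ p : QPath V, IsPerfectPath I p →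
      ¬ Module.Projective (BoundQuiverAlgebra I) (leftIdeal (pathClass I p)) ∧
      IsGorensteinProjective (BoundQuiverAlgebra I) (leftIdeal (pathClass I p))) := by
  refine ⟨fun p hp hp1 hθ _ hG => ?_, fun p hp _ hproj hG => ?_, fun M _ _ hind hproj hG => ?_,
    fun p hp => hp.isGorensteinProjective hI⟩
  · exact IsExtPerfect.isPerfectPath hI ⟨hp, hp1, hθ.2, hG.extVanishing⟩
  · obtain ⟨q, hL, -, hq⟩ :=
      exists_leftAnnihilatorPaths_eq_singleton hI hp hproj hG.extVanishing
    exact ⟨q, ⟨hq.isPerfectPath hI, hL⟩, fun q' hq' =>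
      Set.singleton_injective (hq'.2.symm.trans hL)⟩
  · obtain ⟨n, K, ⟨e⟩, hK⟩ := hG.exists_equiv_submodule
    obtain ⟨p, hp, ⟨e'⟩⟩ :=
      exists_equiv_leftIdeal_of_isIndecomposable hI K hK (hind.of_equiv e)
    have f := e.trans e'
    obtain ⟨q, hq, ⟨g⟩⟩ := exists_isPerfectPath_equiv hI hp
      (fun h => hproj (Module.Projective.of_equiv f.symm))
      (hG.of_equiv f.symm).extVanishing
    exact ⟨q, hq, ⟨f.trans g⟩⟩
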